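/- For a sequence $(M_k)_{k\ge 0}$ of positive real numbers, let $C_{\mathrm{loc}}\{M_k\}$ be the set of all $C^\infty$ functions $f:\mathbb{R}\to\mathbb{R}$ such that for every compact interval $K\subset\mathbb{R}$ there are $\beta,B>0$ with $\sup_{x\in K}|f^{(k)}(x)|\le \beta B^k M_k$ for all $k\ge 0$. A *locally Denjoy–Carleman class* is a class of the form $C_{\mathrm{loc}}\{M_k\}$ for some such sequence. A class $\Gamma$ of $C^\infty$ functions $\mathbb{R}\to\mathbb{R}$ is *quasi-analytic* if every $f\in\Gamma$ for which there is a point $x_0$ with $f^{(k)}(x_0)=0$ for all $k\ge 0$ is identically zero. A *predictor for functions from $\mathbb{R}$ to $\mathbb{R}$* is a map $P$ assigning a real number $P(f)$ to every function $f:(-\infty,t)\to\mathbb{R}$, $t\in\mathbb{R}$. It is *good* if for every function $F:\mathbb{R}\to\mathbb{R}$ the set $\{t\in\mathbb{R} : P(F\restriction(-\infty,t))\ne F(t)\}$ has Lebesgue measure zero. It is *$\Gamma$-anonymous* if $P(f\circ\varphi)=P(f)$ for every increasing bijection $\varphi:\mathbb{R}\to\mathbb{R}$ with $\varphi\in\Gamma$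 and every $f:(-\infty,t)\to\mathbb{R}$, where $f\circ\varphi$ has domain $(-\infty,\varphi^{-1}(t))$. **Corollary.** If $\Gamma$ is a locally Denjoy–Carleman class that is not quasi-analytic, then there is no good $\Gamma$-anonymous predictor for functions from $\mathbb{R}$ to $\mathbb{R}$. -/

import Mathlib

open scoped ContDiff

/-- The class `C_K {M_k}` for a compact interval `K`: real functions that are smooth on `K`
(one-sided derivatives at the endpoints) with `‖f⁽ᵏ⁾‖_K ≤ β * B ^ k * M k` for all `k ≥ 0`, for some
positive `β`, `B`. It only depends on the values of `f` on `K`; it is used for `K = [a, b]`,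
`a < b`. -/
def denjoyCarlemanOn (K : Set ℝ) (M : ℕ → ℝ) : Set (ℝ → ℝ) :=
  {f | ContDiffOn ℝ ∞ f K ∧
    ∃ β B : ℝ, 0 < β ∧ 0 < B ∧
      ∀ k : ℕ, ∀ x ∈ K, |iteratedDerivWithin k f K x| ≤ β * B ^ k * M k}

/-- The class `C_loc {M_k}`: smooth functions `ℝ → ℝ` whose restriction to every (nondegenerate)
compact interval `K` lies in `C_K {M_k}`. -/
def locDenjoyCarleman (M : ℕ → ℝ) : Set (ℝ → ℝ) :=
  {f | ContDiff ℝ ∞ f ∧ ∀ a b : ℝ, a < b → f ∈ denjoyCarlemanOn (Set.Icc a b) M}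

/-- A locally Denjoy–Carleman class is a class `C_loc {M_k}` for a sequence of positive reals. -/
def IsLocallyDenjoyCarlemanClass (Γ : Set (ℝ → ℝ)) : Prop :=
  ∃ M : ℕ → ℝ, (∀ k, 0 < M k) ∧ Γ = locDenjoyCarleman M

/-- A class of smooth functions on `ℝ` is quasi-analytic if its only member with all derivatives
(including the zeroth) vanishing at some point is the zero function. -/
def IsQuasiAnalyticClass (Γ : Set (ℝ → ℝ)) : Prop :=
  ∀ f ∈ Γ, (∃ x₀ : ℝ, ∀ k : ℕ, iteratedDeriv k f x₀ = 0) → ∀ x, f x = 0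

/-- An `S`-predictor guesses a present state in `S` from any past history, i.e. from any function
`(-∞, t) → S`, for any `t`. -/
abbrev Predictor (S : Type*) : Type _ :=
  (t : ℝ) → (Set.Iio t → S) → S

/-- The history `F ↾ (-∞, t)` of `F : ℝ → S` before time `t`. -/
def history {S : Type*} (F : ℝ → S) (t : ℝ) : Set.Iio t → S :=
  fun x => F x

/-- A predictor is good if, for every `F : ℝ → S`, the guess for `F t` based on `F ↾ (-∞, t)` is
correct for Lebesgue-almost every `t`. -/
def Predictor.IsGood {S : Type*} (P : Predictor S) : Prop :=
  ∀ F : ℝ → S, MeasureTheory.volume {t : ℝ | P t (history F t) ≠ F t} = 0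

/-- A predictor is `Γ`-anonymous if its guesses are invariant under distortions of time by the
increasing bijections `φ` of `ℝ` belonging to `Γ`: the histories `f : (-∞, φ s) → S` and
`f ∘ φ : (-∞, s) → S` always receive the same guess. -/
def Predictor.IsAnonymous {S : Type*} (Γ : Set (ℝ → ℝ)) (P : Predictor S) : Prop :=
  ∀ φ : ℝ ≃o ℝ, (φ : ℝ → ℝ) ∈ Γ → ∀ (s : ℝ) (f : Set.Iio (φ s) → S),
    P s (fun x => f ⟨φ x, φ.strictMono x.2⟩) = P (φ s) f

/-! ### Bang's growth estimate -/

/-! The contradiction comes from one 0/1-valued function, `cantorLabel`, whose pasts at many points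
look alike up to time changes in `Γ` while its values at these points differ.

Let `t = cantorPoint k` have base-4 digits 3 at sparse positions `k n` and 0 elsewhere. Just left of
`t` lie blocks of width `4 ^ -(k n + 1)`, one for each `n`. Membership in the label depends only on
the tail of the expansion and is symmetric in even and odd positions, so each block carries a full
copy of `cantorLabel`, and between blocks the label is 0. If `k` grows fast enough, some `ψ` in `Γ`
maps a fixed sequence of blocks converging to 0 onto these (`HasRamps.exists_blowUp`). By anonymity
the guess for `cantorLabel` at `t` is then one number `v`, independent of `k`.

A set of positive measure can be sent by some `φ` in `Γ` into such points, with the parities of the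
positions prescribed (`HasRamps.exists_compression`). Goodness for `cantorLabel ∘ φ` yields a point
of this set where the guess is right, so `v` is the label there. Only even positions force `v = 0`;
alternating parities force `v = 1`.

Building `ψ` and `φ` in `Γ` needs smooth ramps with controlled derivatives (`HasRamps`). A nonzero
function flat at a point yields, by Bang's form of the Denjoy–Carleman theorem, summable radii `α`
with `m 0 * ∏ (α j)⁻¹ ≤ m k` (`exists_summable_minorant`); averaging `max x 0` over these radii
gives the ramps. Everything else uses translates, reflections and convergent series for one fixed
weight sequence `m`, so no closure of `Γ` under composition or inversion is needed. -/

/-- Downward induction on the order. The growth rate `e * μ` is chosen so that the bound for order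
`n` has a derivative dominating the bound for order `n + 1`: the step in order costs `e` from the
exponential and at most `μ` from `c`. -/
theorem abs_iteratedDeriv_le_mul_exp {f : ℝ → ℝ} (hf : ContDiff ℝ ∞ f) {N : ℕ} {c : ℕ → ℝ}
    {μ a b : ℝ} (hc : ∀ n < N, c (n + 1) ≤ μ * c n) (hμ : 0 ≤ μ) (hcpos : ∀ n, 0 ≤ c n)
    (htop : ∀ x ∈ Set.Icc a b, |iteratedDeriv N f x| ≤ c N)
    (ha : ∀ n < N, |iteratedDeriv n f a| ≤ Real.exp ((n : ℝ) - N) * c n) :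
    ∀ n ≤ N, ∀ x ∈ Set.Icc a b,
      |iteratedDeriv n f x| ≤
        Real.exp ((n : ℝ) - N) * c n * Real.exp (Real.exp 1 * μ * (x - a)) := by
  intro n hn
  induction hn using Nat.decreasingInduction with
  | self =>
    intro x hx
    have h1 : 1 ≤ Real.exp (Real.exp 1 * μ * (x - a)) :=
      Real.one_le_exp (mul_nonneg (by positivity) (by linarith [hx.1]))
    have := htop x hx
    simp only [sub_self, Real.exp_zero, one_mul]
    nlinarith [hcpos N]
  | of_succ n hn ih =>
    have hd : ∀ x, HasDerivAt (iteratedDeriv n f) (iteratedDeriv (n + 1) f x) x := by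
      intro x
      rw [iteratedDeriv_succ]
      exact ((hf.differentiable_iteratedDeriv n (by exact_mod_cast WithTop.coe_lt_top _)) x).hasDerivAt
    refine image_norm_le_of_norm_deriv_right_le_deriv_boundary (f' := iteratedDeriv (n + 1) f)
      (B := fun x => Real.exp ((n : ℝ) - N) * c n * Real.exp (Real.exp 1 * μ * (x - a)))
      (B' := fun x => Real.exp ((n : ℝ) - N) * c n *
        (Real.exp (Real.exp 1 * μ * (x - a)) * (Real.exp 1 * μ)))
      (fun x _ => (hd x).continuousAt.continuousWithinAt)
      (fun x _ => (hd x).hasDerivWithinAt) ?_ ?_ ?_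
    · simpa using ha n hn
    · intro x
      have h1 : HasDerivAt (fun x => Real.exp 1 * μ * (x - a)) (Real.exp 1 * μ) x := by
        simpa using ((hasDerivAt_id x).sub_const a).const_mul (Real.exp 1 * μ)
      exact (h1.exp).const_mul _
    · intro x hx
      refine (ih x ⟨hx.1, hx.2.le⟩).trans ?_
      have h1 := hc n hn
      have h2 : Real.exp (((n + 1 : ℕ) : ℝ) - N) = Real.exp ((n : ℝ) - N) * Real.exp 1 := by
        rw [← Real.exp_add]; congr 1; push_cast; ring
      rw [h2]
      calc _ ≤ Real.exp ((n : ℝ) - N) * Real.exp 1 * (μ * c n) *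
            Real.exp (Real.exp 1 * μ * (x - a)) := by gcongr
        _ = _ := by ring

/-- With geometric weights the growth estimate gains `exp (-N)` against a factor independent of `N`.
Consequently a flat function that is nonzero at `b` forces `log (m n)` to grow superlinearly. -/
theorem eq_zero_of_frequently_le_pow {f : ℝ → ℝ} (hf : ContDiff ℝ ∞ f) {a b R : ℝ} {m : ℕ → ℝ}
    (hab : a ≤ b) (hR : 0 < R) (hm : ∃ᶠ n in Filter.atTop, m n ≤ R ^ n)
    (hbd : ∀ k, ∀ x ∈ Set.Icc a b, |iteratedDeriv k f x| ≤ m k)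
    (ha : ∀ k, iteratedDeriv k f a = 0) : f b = 0 := by
  have key : ∃ᶠ n : ℕ in Filter.atTop, |f b| ≤
      Real.exp (-(n : ℝ)) * Real.exp (Real.exp 1 * R * (b - a)) := by
    refine hm.mono fun N hN => ?_
    have := abs_iteratedDeriv_le_mul_exp hf (N := N) (c := fun n => R ^ n) (μ := R) (a := a) (b := b)
      (fun n _ => by simp only [pow_succ]; rw [mul_comm]) hR.le (fun n => by positivity)
      (fun x hx => (hbd N x hx).trans hN) (fun n _ => by rw [ha]; simp; positivity) 0 (Nat.zero_le _)
      b ⟨hab, le_rfl⟩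
    simpa using this
  have lim : Filter.Tendsto (fun n : ℕ => Real.exp (-(n : ℝ)) * Real.exp (Real.exp 1 * R * (b - a)))
      Filter.atTop (nhds 0) := by
    have := (Real.tendsto_exp_neg_atTop_nhds_zero.comp tendsto_natCast_atTop_atTop).mul_const
      (Real.exp (Real.exp 1 * R * (b - a)))
    simpa using this
  have : |f b| ≤ 0 := ge_of_tendsto_of_frequently lim key
  simpa using this

/-! ### The convex minorant of a sequence of superlinear growth -/

/-- Superlinear growth pushes the slopes from `N` above the first of them outside a finite window,
so the minimum is attained inside it. -/
theorem exists_minimal_slope {L : ℕ → ℝ} (hL : ∀ s : ℝ, ∀ᶠ n : ℕ in Filter.atTop, s * n ≤ L n)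
    (N : ℕ) : ∃ N', N < N' ∧ ∀ n, N < n →
      (L N' - L N) / ((N' : ℝ) - N) ≤ (L n - L N) / ((n : ℝ) - N) := by
  set g : ℕ → ℝ := fun n => (L n - L N) / ((n : ℝ) - N) with hg
  obtain ⟨K, hK⟩ := Filter.eventually_atTop.1 ((hL (|g (N + 1)| + |L N|)).and
    (Filter.eventually_gt_atTop N))
  obtain ⟨N', hN', hmin⟩ := (Finset.Icc (N + 1) (N + 1 + K)).exists_min_image g ⟨N + 1, by simp⟩
  rw [Finset.mem_Icc] at hN'
  refine ⟨N', by omega, fun n hn => ?_⟩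
  by_cases hnK : n ≤ N + 1 + K
  · exact hmin n (by rw [Finset.mem_Icc]; omega)
  · have h1 : g N' ≤ g (N + 1) := hmin (N + 1) (by simp)
    refine h1.trans ?_
    obtain ⟨h2, h3⟩ := hK n (by omega)
    have h4 : (1 : ℝ) ≤ (n : ℝ) - N := by
      have : ((N + 1 : ℕ) : ℝ) ≤ n := by exact_mod_cast hn
      push_cast at this; linarith
    rw [hg]
    simp only
    rw [le_div_iff₀ (by linarith)]
    change g (N + 1) * _ ≤ _
    have h5 := le_abs_self (g (N + 1))
    have h6 := le_abs_self (L N)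
    have h7 := abs_nonneg (g (N + 1))
    have h8 := abs_nonneg (L N)
    have h9 : (0 : ℝ) ≤ N := by positivity
    nlinarith [mul_le_mul_of_nonneg_right h5 (by linarith : (0 : ℝ) ≤ (n : ℝ) - N)]

/-- The polygon is built greedily, going from each vertex `V i` to a point of least slope; `σ` lists
its slopes. Contact with `L` at the vertices and constancy of `σ` between them are what Bang's
argument uses. -/
theorem exists_convex_minorant {L : ℕ → ℝ}
    (hL : ∀ s : ℝ, ∀ᶠ n : ℕ in Filter.atTop, s * n ≤ L n) :
    ∃ (σ : ℕ → ℝ) (V : ℕ → ℕ), Monotone σ ∧ StrictMono V ∧ V 0 = 0 ∧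
      (∀ n, L 0 + ∑ j ∈ Finset.range n, σ j ≤ L n) ∧
      (∀ i, L 0 + ∑ j ∈ Finset.range (V i), σ j = L (V i)) ∧
      ∀ i j, V i ≤ j → j < V (i + 1) → σ j = σ (V i) := by
  choose nxt hnxt hslope using exists_minimal_slope hL
  set V : ℕ → ℕ := fun i => nxt^[i] 0 with hV
  have hVs : ∀ i, V (i + 1) = nxt (V i) := fun i => Function.iterate_succ_apply' nxt i 0
  have hmono : StrictMono V := strictMono_nat_of_lt_succ fun i => by rw [hVs]; exact hnxt _
  set s : ℕ → ℝ := fun i => (L (V (i + 1)) - L (V i)) / ((V (i + 1) : ℝ) - V i) with hs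
  have hpos : ∀ i, (0 : ℝ) < (V (i + 1) : ℝ) - V i := fun i => by
    have : (V i : ℝ) < V (i + 1) := by exact_mod_cast hmono (Nat.lt_succ_self i)
    linarith
  have hline : ∀ i n, V i ≤ n → L (V i) + s i * ((n : ℝ) - V i) ≤ L n := by
    intro i n hn
    rcases hn.eq_or_lt with rfl | hn
    · simp
    · have h1 := hslope (V i) n hn
      rw [← hVs] at h1
      have h2 : (0 : ℝ) < (n : ℝ) - V i := by
        have : (V i : ℝ) < n := by exact_mod_cast hn
        linarith
      rw [le_div_iff₀ h2] at h1
      linarith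
  have hend : ∀ i, L (V i) + s i * ((V (i + 1) : ℝ) - V i) = L (V (i + 1)) := by
    intro i
    have := (hpos i).ne'
    rw [hs]; simp only; rw [div_mul_cancel₀ _ this]; ring
  have hsmono : Monotone s := by
    refine monotone_nat_of_le_succ fun i => ?_
    have h1 := hline i (V (i + 2)) (hmono.monotone (by omega))
    have h2 := hend i
    have h3 := hend (i + 1)
    have h4 : s i * ((V (i + 2) : ℝ) - V (i + 1)) ≤ s (i + 1) * ((V (i + 2) : ℝ) - V (i + 1)) := by
      linarith
    exact le_of_mul_le_mul_right h4 (hpos (i + 1))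
  set idx : ℕ → ℕ := fun j => Nat.findGreatest (fun i => V i ≤ j) j with hidx
  have hV0 : V 0 = 0 := rfl
  have hidx_eq : ∀ i j, V i ≤ j → j < V (i + 1) → idx j = i := by
    intro i j h1 h2
    have h3 : i ≤ idx j := Nat.le_findGreatest ((hmono.id_le i).trans h1) h1
    have h4 : V (idx j) ≤ j :=
      Nat.findGreatest_spec (P := fun i => V i ≤ j) (m := 0) (Nat.zero_le _) (by simp [hV0])
    have h5 : idx j < i + 1 := hmono.lt_iff_lt.1 (h4.trans_lt h2)
    omega
  have hidx_le : ∀ j, V (idx j) ≤ j := fun j =>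
    Nat.findGreatest_spec (P := fun i => V i ≤ j) (m := 0) (Nat.zero_le _) (by simp [hV0])
  have hidx_lt : ∀ j, j < V (idx j + 1) := by
    intro j
    by_contra! h
    have : idx j + 1 ≤ idx j := Nat.le_findGreatest ((hmono.id_le _).trans h) h
    omega
  have hidx_mono : Monotone idx := by
    intro j k hjk
    exact Nat.le_findGreatest (((hmono.id_le _).trans (hidx_le j)).trans hjk) ((hidx_le j).trans hjk)
  have hsum : ∀ i n, V i ≤ n → n ≤ V (i + 1) →
      ∑ j ∈ Finset.Ico (V i) n, s (idx j) = s i * ((n : ℝ) - V i) := by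
    intro i n h1 h2
    rw [Finset.sum_congr rfl (g := fun _ => s i), Finset.sum_const, Nat.card_Ico, nsmul_eq_mul,
      Nat.cast_sub h1, mul_comm]
    intro j hj
    rw [Finset.mem_Ico] at hj
    rw [hidx_eq i j hj.1 (by omega)]
  have hvert : ∀ i, L 0 + ∑ j ∈ Finset.range (V i), s (idx j) = L (V i) := by
    intro i
    induction i with
    | zero => simp [hV0]
    | succ i ih =>
      have hle : V i ≤ V (i + 1) := hmono.monotone (Nat.le_succ i)
      rw [← Finset.sum_range_add_sum_Ico _ hle, hsum i _ hle le_rfl]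
      linarith [hend i]
  refine ⟨fun j => s (idx j), V, hsmono.comp hidx_mono, hmono, hV0, fun n => ?_, hvert, ?_⟩
  · rw [← Finset.sum_range_add_sum_Ico _ (hidx_le n),
      hsum (idx n) n (hidx_le n) (hidx_lt n).le]
    linarith [hvert (idx n), hline (idx n) n (hidx_le n)]
  · intro i j h1 h2
    simp only
    rw [hidx_eq i j h1 h2, hidx_eq i (V i) le_rfl (hmono (Nat.lt_succ_self i))]

/-! ### The convergence half of the Denjoy–Carleman theorem -/

/-- Bang's argument. At `a` all derivatives vanish, so the estimate holds there at every vertex.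
Descending from vertex `i + 1` to vertex `i` weakens the factor `exp (n - V (i + 1))` to `exp (n - V
i)`. At growth rate `e * exp (σ (V i))` this pays for an extra length `(V (i + 1) - V i) * exp (-σ
(V i)) / e`, the contribution of that segment to the sum. -/
theorem abs_iteratedDeriv_le_of_vertices {f : ℝ → ℝ} (hf : ContDiff ℝ ∞ f) {a b : ℝ} {m : ℕ → ℝ}
    (hbd : ∀ k, ∀ x ∈ Set.Icc a b, |iteratedDeriv k f x| ≤ m k)
    (ha : ∀ k, iteratedDeriv k f a = 0) {σ c : ℕ → ℝ} {V : ℕ → ℕ} (hσ : Monotone σ)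
    (hV : StrictMono V) (hcpos : ∀ n, 0 < c n) (hc : ∀ n, c (n + 1) = Real.exp (σ n) * c n)
    (hcV : ∀ i, c (V i) = m (V i)) (hσV : ∀ i j, V i ≤ j → j < V (i + 1) → σ j = σ (V i)) (d : ℕ) :
    ∀ i, ∀ x ∈ Set.Icc a b,
      x ≤ a + (∑ j ∈ Finset.Ico (V i) (V (i + d)), Real.exp (-σ j)) / Real.exp 1 →
      ∀ n ≤ V i, |iteratedDeriv n f x| ≤ Real.exp ((n : ℝ) - V i) * c n := by
  induction d with
  | zero =>
    intro i x hx hxT n _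
    have : x = a := le_antisymm (by simpa using hxT) hx.1
    rw [this, ha, abs_zero]
    have := hcpos n
    positivity
  | succ d ih =>
    intro i x hx hxT n hn
    have hlt : V i < V (i + 1) := hV (Nat.lt_succ_self i)
    have hle : V (i + 1) ≤ V (i + 1 + d) := hV.monotone (by omega)
    set T' : ℝ := (∑ j ∈ Finset.Ico (V (i + 1)) (V (i + 1 + d)), Real.exp (-σ j)) / Real.exp 1
      with hT'
    have hT'0 : 0 ≤ T' := by positivity
    by_cases hxT' : x ≤ a + T'
    · refine (ih (i + 1) x hx hxT' n (hn.trans hlt.le)).trans ?_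
      have := (hcpos n).le
      have hlt' : (V i : ℝ) ≤ V (i + 1) := by exact_mod_cast hlt.le
      gcongr
    · push Not at hxT'
      have hend : a + T' ∈ Set.Icc a b := ⟨by linarith, hxT'.le.trans hx.2⟩
      have key := abs_iteratedDeriv_le_mul_exp hf (N := V (i + 1)) (c := c)
        (μ := Real.exp (σ (V i))) (a := a + T') (b := b) (fun n hn => by
          rw [hc]
          refine mul_le_mul_of_nonneg_right (Real.exp_le_exp.2 ?_) (hcpos n).le
          by_cases h : V i ≤ n
          · exact (hσV i n h hn).le
          · exact hσ (by omega)) (Real.exp_pos _).le (fun n => (hcpos n).le)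
        (fun y hy => (hbd _ y ⟨hend.1.trans hy.1, hy.2⟩).trans (hcV _).ge)
        (fun n hn => ih (i + 1) _ hend le_rfl n hn.le) n (hn.trans hlt.le) x ⟨hxT'.le, hx.2⟩
      refine key.trans ?_
      have hsum : ∑ j ∈ Finset.Ico (V i) (V (i + 1)), Real.exp (-σ j) =
          ((V (i + 1) : ℝ) - V i) * Real.exp (-σ (V i)) := by
        rw [Finset.sum_congr rfl (g := fun _ => Real.exp (-σ (V i))), Finset.sum_const,
          Nat.card_Ico, nsmul_eq_mul, Nat.cast_sub hlt.le]
        intro j hj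
        rw [Finset.mem_Ico] at hj
        rw [hσV i j hj.1 hj.2]
      have hxT2 : x - (a + T') ≤ ((V (i + 1) : ℝ) - V i) * Real.exp (-σ (V i)) / Real.exp 1 := by
        rw [show i + (d + 1) = i + 1 + d by ring,
          ← Finset.sum_Ico_consecutive _ hlt.le hle, add_div, ← hT', hsum] at hxT
        linarith
      have hexp : Real.exp 1 * Real.exp (σ (V i)) * (x - (a + T')) ≤ (V (i + 1) : ℝ) - V i := by
        calc _ ≤ Real.exp 1 * Real.exp (σ (V i)) *
              (((V (i + 1) : ℝ) - V i) * Real.exp (-σ (V i)) / Real.exp 1) := by gcongr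
          _ = _ := by
            rw [Real.exp_neg]
            field_simp
      calc _ ≤ Real.exp ((n : ℝ) - V (i + 1)) * c n * Real.exp ((V (i + 1) : ℝ) - V i) := by
            have := (hcpos n).le
            gcongr
        _ = Real.exp ((n : ℝ) - V (i + 1)) * Real.exp ((V (i + 1) : ℝ) - V i) * c n := by ring
        _ = _ := by rw [← Real.exp_add]; congr 2; ring

/-- The radii are `exp (-σ j)` for the slopes `σ` of the convex minorant of `log m`. Were their sum
infinite, Bang's estimate would reach `b` from every vertex, giving `|f b| ≤ exp (-i) * c 0` for all
`i`. -/
theorem exists_summable_minorant {f : ℝ → ℝ} (hf : ContDiff ℝ ∞ f) {a b : ℝ} {m : ℕ → ℝ}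
    (hm : ∀ k, 0 < m k) (hab : a ≤ b) (hbd : ∀ k, ∀ x ∈ Set.Icc a b, |iteratedDeriv k f x| ≤ m k)
    (ha : ∀ k, iteratedDeriv k f a = 0) (hb : f b ≠ 0) :
    ∃ α : ℕ → ℝ, (∀ j, 0 < α j) ∧ Summable α ∧
      ∀ k, m 0 * ∏ j ∈ Finset.range k, (α j)⁻¹ ≤ m k := by
  set L : ℕ → ℝ := fun n => Real.log (m n) with hLdef
  have hL : ∀ s : ℝ, ∀ᶠ n : ℕ in Filter.atTop, s * n ≤ L n := by
    intro s
    by_contra h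
    refine hb (eq_zero_of_frequently_le_pow hf hab (Real.exp_pos s) ?_ hbd ha)
    refine (Filter.not_eventually.1 h).mono fun n hn => ?_
    rw [not_le, hLdef, Real.log_lt_iff_lt_exp (hm n)] at hn
    rw [← Real.exp_nat_mul, mul_comm]
    exact hn.le
  obtain ⟨σ, V, hσ, hV, hV0, hle, heq, hconst⟩ := exists_convex_minorant hL
  set c : ℕ → ℝ := fun n => Real.exp (L 0 + ∑ j ∈ Finset.range n, σ j) with hc
  have hcm : ∀ n, c n = m 0 * ∏ j ∈ Finset.range n, (Real.exp (-σ j))⁻¹ := by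
    intro n
    simp only [hc, hLdef, Real.exp_add, Real.exp_log (hm 0), Real.exp_sum, Real.exp_neg, inv_inv]
  refine ⟨fun j => Real.exp (-σ j), fun j => Real.exp_pos _, ?_, fun k => ?_⟩
  · by_contra hns
    have hT := (not_summable_iff_tendsto_nat_atTop_of_nonneg (fun j => (Real.exp_pos (-σ j)).le)).1
      hns
    have key : ∀ i : ℕ, |f b| ≤ Real.exp (-(i : ℝ)) * c 0 := by
      intro i
      obtain ⟨n, hn⟩ := (hT.eventually_ge_atTop ((b - a) * Real.exp 1 +
        ∑ j ∈ Finset.range (V i), Real.exp (-σ j))).exists_forall_of_atTop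
      have h1 := hn (V (i + n)) ((hV.id_le n).trans (hV.monotone (by omega)))
      rw [← Finset.sum_range_add_sum_Ico _ (hV.monotone (by omega : i ≤ i + n))] at h1
      have h2 := abs_iteratedDeriv_le_of_vertices hf hbd ha hσ hV (c := c)
        (fun n => Real.exp_pos _) (fun n => by
          simp only [hc, Finset.sum_range_succ, ← Real.exp_add]; congr 1; ring)
        (fun i => by simp only [hc]; rw [heq, hLdef, Real.exp_log (hm _)]) hconst n i b ⟨hab, le_rfl⟩
        (by
          have : b - a ≤ (∑ j ∈ Finset.Ico (V i) (V (i + n)), Real.exp (-σ j)) / Real.exp 1 := by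
            rw [le_div_iff₀ (Real.exp_pos 1)]; linarith
          linarith) 0 (Nat.zero_le _)
      rw [iteratedDeriv_zero] at h2
      refine h2.trans (mul_le_mul_of_nonneg_right (Real.exp_le_exp.2 ?_) (Real.exp_pos _).le)
      have : (i : ℝ) ≤ V i := by exact_mod_cast hV.id_le i
      simpa using this
    have lim : Filter.Tendsto (fun n : ℕ => Real.exp (-(n : ℝ)) * c 0) Filter.atTop (nhds 0) := by
      simpa using (Real.tendsto_exp_neg_atTop_nhds_zero.comp
        tendsto_natCast_atTop_atTop).mul_const (c 0)
    exact hb (abs_nonpos_iff.1 (ge_of_tendsto' lim key))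
  · rw [← hcm]
    refine (Real.exp_le_exp.2 (hle k)).trans ?_
    rw [hLdef, Real.exp_log (hm k)]

/-! ### Smooth ramps by iterated averaging -/

/-- The mean of `f` over the interval of radius `a` around `x`. -/
noncomputable def slidingAverage (a : ℝ) (f : ℝ → ℝ) (x : ℝ) : ℝ :=
  (1 / 2) * ∫ u in (-1 : ℝ)..1, f (x + a * u)

/-- The function `f` is `1`-Lipschitz, has monotone increments, and agrees with `x ↦ max x 0`
outside of `(-s, s)`. -/
structure IsRamp (s : ℝ) (f : ℝ → ℝ) : Prop where
  lip : ∀ x y, |f x - f y| ≤ |x - y|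
  incr : ∀ d, 0 ≤ d → ∀ x y, x ≤ y → f (x + d) - f x ≤ f (y + d) - f y
  left : ∀ x, x ≤ -s → f x = 0
  right : ∀ x, s ≤ x → f x = x

theorem IsRamp.continuous {s : ℝ} {f : ℝ → ℝ} (hf : IsRamp s f) : Continuous f := by
  have : LipschitzWith 1 f := LipschitzWith.of_dist_le_mul fun x y => by
    simpa [Real.dist_eq] using hf.lip x y
  exact this.continuous

theorem IsRamp.mono {s t : ℝ} {f : ℝ → ℝ} (hf : IsRamp s f) (h : s ≤ t) : IsRamp t f :=
  ⟨hf.lip, hf.incr, fun x hx => hf.left x (by linarith), fun x hx => hf.right x (by linarith)⟩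

theorem isRamp_max : IsRamp 0 fun x => max x 0 where
  lip x y := by simpa using abs_max_sub_max_le_max x 0 y 0
  incr d hd x y hxy := by grind
  left x hx := by simpa using hx
  right x hx := by simpa using hx

theorem intervalIntegrable_slidingAverage {f : ℝ → ℝ} (hf : Continuous f) (a x : ℝ) :
    IntervalIntegrable (fun u => f (x + a * u)) MeasureTheory.volume (-1) 1 :=
  (hf.comp (by fun_prop)).intervalIntegrable _ _

theorem abs_slidingAverage_sub_le {f g : ℝ → ℝ} (hf : Continuous f) (hg : Continuous g)
    {a b x y C : ℝ} (h : ∀ u ∈ Set.Icc (-1 : ℝ) 1, |f (x + a * u) - g (y + b * u)| ≤ C) :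
    |slidingAverage a f x - slidingAverage b g y| ≤ C := by
  rw [slidingAverage, slidingAverage, ← mul_sub, ← intervalIntegral.integral_sub
    (intervalIntegrable_slidingAverage hf a x) (intervalIntegrable_slidingAverage hg b y), abs_mul]
  have := intervalIntegral.norm_integral_le_of_norm_le_const (a := -1) (b := 1) (C := C)
    (f := fun u => f (x + a * u) - g (y + b * u)) (fun u hu => by
      rw [Set.uIoc_of_le (by norm_num)] at hu
      exact h u ⟨hu.1.le, hu.2⟩)
  rw [Real.norm_eq_abs] at this
  have h2 : |(1 : ℝ) - -1| = 2 := by norm_num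
  rw [h2] at this
  rw [abs_of_pos (by norm_num : (0 : ℝ) < 1 / 2)]
  linarith

theorem slidingAverage_zero_radius (f : ℝ → ℝ) (x : ℝ) : slidingAverage 0 f x = f x := by
  simp [slidingAverage]; ring

theorem IsRamp.abs_slidingAverage_sub_self_le {s a : ℝ} {f : ℝ → ℝ} (hf : IsRamp s f) (ha : 0 ≤ a)
    (x : ℝ) : |slidingAverage a f x - f x| ≤ a := by
  rw [← slidingAverage_zero_radius f x]
  refine (abs_slidingAverage_sub_le hf.continuous hf.continuous fun u hu => ?_)
  refine (hf.lip _ _).trans ?_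
  rw [show x + a * u - (x + 0 * u) = a * u by ring, abs_mul, abs_of_nonneg ha]
  exact mul_le_of_le_one_right ha (abs_le.2 hu)

/-- Symmetric averages fix affine functions, so only the bending zone widens, by `a`. -/
theorem IsRamp.slidingAverage {s a : ℝ} {f : ℝ → ℝ} (hf : IsRamp s f) (ha : 0 ≤ a) :
    IsRamp (s + a) (slidingAverage a f) where
  lip x y := abs_slidingAverage_sub_le hf.continuous hf.continuous fun u _ => by
    simpa using hf.lip (x + a * u) (y + a * u)
  incr d hd x y hxy := by
    simp only [_root_.slidingAverage]
    rw [← mul_sub, ← mul_sub, ← intervalIntegral.integral_sub, ← intervalIntegral.integral_sub]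
    · refine mul_le_mul_of_nonneg_left ?_ (by norm_num)
      refine intervalIntegral.integral_mono_on (by norm_num) ?_ ?_ fun u _ => ?_
      · exact (intervalIntegrable_slidingAverage hf.continuous _ _).sub
          (intervalIntegrable_slidingAverage hf.continuous _ _)
      · exact (intervalIntegrable_slidingAverage hf.continuous _ _).sub
          (intervalIntegrable_slidingAverage hf.continuous _ _)
      · have := hf.incr d hd (x + a * u) (y + a * u) (by linarith)
        rw [show x + d + a * u = x + a * u + d by ring, show y + d + a * u = y + a * u + d by ring]
        exact this
    all_goals exact intervalIntegrable_slidingAverage hf.continuous _ _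
  left x hx := by
    rw [_root_.slidingAverage, intervalIntegral.integral_congr (g := fun _ => 0)]
    · simp
    · intro u hu
      rw [Set.uIcc_of_le (by norm_num)] at hu
      exact hf.left _ (by nlinarith [hu.2])
  right x hx := by
    rw [_root_.slidingAverage, intervalIntegral.integral_congr (g := fun u => x + a * u)]
    · rw [intervalIntegral.integral_add (by simp) (by
        exact (Continuous.intervalIntegrable (by fun_prop) _ _)),
        intervalIntegral.integral_const_mul, integral_id, intervalIntegral.integral_const]
      simp only [smul_eq_mul]
      ring
    · intro u hu
      rw [Set.uIcc_of_le (by norm_num)] at hu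
      exact hf.right _ (by nlinarith [hu.1])

theorem hasDerivAt_slidingAverage {f : ℝ → ℝ} (hf : Continuous f) {a : ℝ} (ha : 0 < a) (x : ℝ) :
    HasDerivAt (slidingAverage a f) ((2 * a)⁻¹ * (f (x + a) - f (x - a))) x := by
  have h1 : slidingAverage a f =
      fun x => (2 * a)⁻¹ * ((∫ y in (0 : ℝ)..(x + a), f y) - ∫ y in (0 : ℝ)..(x - a), f y) := by
    funext x
    rw [intervalIntegral.integral_interval_sub_left (hf.intervalIntegrable _ _)
      (hf.intervalIntegrable _ _), slidingAverage, intervalIntegral.integral_comp_add_mul f ha.ne' x,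
      smul_eq_mul]
    rw [show x + a * -1 = x - a by ring, mul_one, mul_inv]
    ring
  have h2 : ∀ z, HasDerivAt (fun w => ∫ y in (0 : ℝ)..w, f y) (f z) z := fun z =>
    intervalIntegral.integral_hasDerivAt_right (hf.intervalIntegrable _ _)
      hf.stronglyMeasurable.stronglyMeasurableAtFilter hf.continuousAt
  rw [h1]
  exact (((h2 (x + a)).comp_add_const x a).sub ((h2 (x - a)).comp_sub_const x a)).const_mul _

/-- The function `x ↦ max x 0` averaged successively with radii `α (n - 1)`, ..., `α 0`. -/
noncomputable def iteratedAverage : ℕ → (ℕ → ℝ) → ℝ → ℝ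
  | 0, _ => fun x => max x 0
  | n + 1, α => slidingAverage (α 0) (iteratedAverage n fun j => α (j + 1))

theorem isRamp_iteratedAverage (n : ℕ) : ∀ α : ℕ → ℝ, (∀ j, 0 ≤ α j) →
    IsRamp (∑ j ∈ Finset.range n, α j) (iteratedAverage n α) := by
  induction n with
  | zero => intro α _; simpa [iteratedAverage] using isRamp_max
  | succ n ih =>
    intro α hα
    rw [Finset.sum_range_succ']
    exact (ih _ fun j => hα (j + 1)).slidingAverage (hα 0)

/-- The additional radius `α n` enters as the innermost average, where it moves the ramp by at most
`α n`; the outer averages do not increase this error. -/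
theorem abs_iteratedAverage_succ_sub_le (n : ℕ) : ∀ α : ℕ → ℝ, (∀ j, 0 ≤ α j) → ∀ x,
    |iteratedAverage n α x - iteratedAverage (n + 1) α x| ≤ α n := by
  induction n with
  | zero =>
    intro α hα x
    rw [abs_sub_comm]
    exact isRamp_max.abs_slidingAverage_sub_self_le (hα 0) x
  | succ n ih =>
    intro α hα x
    exact abs_slidingAverage_sub_le (isRamp_iteratedAverage n _ fun j => hα (j + 1)).continuous
      (isRamp_iteratedAverage (n + 1) _ fun j => hα (j + 1)).continuous
      fun u _ => ih _ (fun j => hα (j + 1)) _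

/-- The limit of `iteratedAverage n α`. -/
noncomputable def smoothRamp (α : ℕ → ℝ) (x : ℝ) : ℝ :=
  Filter.lim (Filter.map (fun n => iteratedAverage n α x) Filter.atTop)

theorem tendsto_iteratedAverage {α : ℕ → ℝ} (h0 : ∀ j, 0 ≤ α j) (hα : Summable α) (x : ℝ) :
    Filter.Tendsto (fun n => iteratedAverage n α x) Filter.atTop (nhds (smoothRamp α x)) :=
  le_nhds_lim (cauchySeq_tendsto_of_complete (cauchySeq_of_dist_le_of_summable α
    (fun n => (Real.dist_eq _ _).trans_le (abs_iteratedAverage_succ_sub_le n α h0 x)) hα))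

theorem isRamp_smoothRamp {α : ℕ → ℝ} (h0 : ∀ j, 0 ≤ α j) (hα : Summable α) :
    IsRamp (∑' j, α j) (smoothRamp α) := by
  have hlim := tendsto_iteratedAverage h0 hα
  have hr : ∀ n, IsRamp (∑' j, α j) (iteratedAverage n α) := fun n =>
    (isRamp_iteratedAverage n α h0).mono (hα.sum_le_tsum _ fun j _ => h0 j)
  refine ⟨fun x y => ?_, fun d hd x y hxy => ?_, fun x hx => ?_, fun x hx => ?_⟩
  · exact le_of_tendsto' ((hlim x).sub (hlim y)).abs fun n => (hr n).lip x y
  · exact le_of_tendsto_of_tendsto' ((hlim _).sub (hlim _)) ((hlim _).sub (hlim _))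
      fun n => (hr n).incr d hd x y hxy
  · exact tendsto_nhds_unique (hlim x) (by
      simp only [fun n => (hr n).left x hx]; exact tendsto_const_nhds)
  · exact tendsto_nhds_unique (hlim x) (by
      simp only [fun n => (hr n).right x hx]; exact tendsto_const_nhds)

/-- Convergence is uniform in the point, so the limit passes through the outermost average. -/
theorem smoothRamp_eq_slidingAverage {α : ℕ → ℝ} (h0 : ∀ j, 0 ≤ α j) (hα : Summable α) :
    smoothRamp α = slidingAverage (α 0) (smoothRamp fun j => α (j + 1)) := by
  have h0' : ∀ j, 0 ≤ α (j + 1) := fun j => h0 (j + 1)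
  have hα' : Summable fun j => α (j + 1) := (summable_nat_add_iff 1).2 hα
  funext x
  refine tendsto_nhds_unique ((tendsto_iteratedAverage h0 hα x).comp
    (Filter.tendsto_add_atTop_nat 1)) ?_
  have hb : ∀ n y, |iteratedAverage n (fun j => α (j + 1)) y - smoothRamp (fun j => α (j + 1)) y| ≤
      ∑' k, α (n + k + 1) := by
    intro n y
    have := dist_le_tsum_of_dist_le_of_tendsto (fun j => α (j + 1))
      (fun n => by simpa [Real.dist_eq] using abs_iteratedAverage_succ_sub_le n _ h0' y)
      hα' (tendsto_iteratedAverage h0' hα' y) n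
    simpa [Real.dist_eq] using this
  rw [tendsto_iff_dist_tendsto_zero]
  refine squeeze_zero (fun n => dist_nonneg) (fun n => ?_)
    (tendsto_sum_nat_add fun j => α (j + 1))
  rw [Real.dist_eq]
  refine (abs_slidingAverage_sub_le (isRamp_iteratedAverage n _ h0').continuous
    (isRamp_smoothRamp h0' hα').continuous fun u _ => hb n _).trans (le_of_eq ?_)
  congr 1; funext k; congr 2; ring

theorem deriv_smoothRamp {α : ℕ → ℝ} (h0 : ∀ j, 0 < α j) (hα : Summable α) :
    (∀ x, DifferentiableAt ℝ (smoothRamp α) x) ∧ deriv (smoothRamp α) = fun x =>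
      (2 * α 0)⁻¹ * (smoothRamp (fun j => α (j + 1)) (x + α 0) -
        smoothRamp (fun j => α (j + 1)) (x - α 0)) := by
  have hc := (isRamp_smoothRamp (fun j => (h0 (j + 1)).le)
    ((summable_nat_add_iff 1).2 hα : Summable fun j => α (j + 1))).continuous
  have h := fun x => hasDerivAt_slidingAverage hc (h0 0) x
  rw [← smoothRamp_eq_slidingAverage (fun j => (h0 j).le) hα] at h
  exact ⟨fun x => (h x).differentiableAt, funext fun x => (h x).deriv⟩

theorem contDiff_smoothRamp_nat (n : ℕ) : ∀ α : ℕ → ℝ, (∀ j, 0 < α j) → Summable α →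
    ContDiff ℝ n (smoothRamp α) := by
  induction n with
  | zero =>
    intro α h0 hα
    exact contDiff_zero.2 (isRamp_smoothRamp (fun j => (h0 j).le) hα).continuous
  | succ n ih =>
    intro α h0 hα
    obtain ⟨h1, h2⟩ := deriv_smoothRamp h0 hα
    have h3 := ih (fun j => α (j + 1)) (fun j => h0 (j + 1)) ((summable_nat_add_iff 1).2 hα)
    push_cast
    rw [contDiff_succ_iff_deriv]
    refine ⟨h1, by simp, ?_⟩
    rw [h2]
    exact contDiff_const.mul ((h3.comp (contDiff_id.add contDiff_const)).sub
      (h3.comp (contDiff_id.sub contDiff_const)))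

theorem contDiff_smoothRamp {α : ℕ → ℝ} (h0 : ∀ j, 0 < α j) (hα : Summable α) :
    ContDiff ℝ ∞ (smoothRamp α) :=
  contDiff_infty.2 fun n => contDiff_smoothRamp_nat n α h0 hα

/-- Each differentiation trades the outermost average for a symmetric difference quotient, whose two
terms cancel the 2 in `(2 * α 0)⁻¹`. The first derivative costs nothing, by the Lipschitz bound,
whence the shift of index. -/
theorem abs_iteratedDeriv_smoothRamp_le (n : ℕ) : ∀ α : ℕ → ℝ, (∀ j, 0 < α j) → Summable α →
    ∀ x, |iteratedDeriv (n + 1) (smoothRamp α) x| ≤ ∏ j ∈ Finset.range n, (α j)⁻¹ := by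
  induction n with
  | zero =>
    intro α h0 hα x
    obtain ⟨-, h2⟩ := deriv_smoothRamp h0 hα
    have h3 := (isRamp_smoothRamp (fun j => (h0 (j + 1)).le)
      ((summable_nat_add_iff 1).2 hα : Summable fun j => α (j + 1))).lip (x + α 0) (x - α 0)
    have h4 := h0 0
    rw [show x + α 0 - (x - α 0) = 2 * α 0 by ring, abs_of_pos (by linarith : 0 < 2 * α 0)] at h3
    rw [zero_add, iteratedDeriv_one, h2, abs_mul, abs_of_pos (by positivity)]
    simp only [Finset.range_zero, Finset.prod_empty]
    rw [inv_mul_le_iff₀ (by positivity)]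
    linarith
  | succ n ih =>
    intro α h0 hα x
    obtain ⟨-, h2⟩ := deriv_smoothRamp h0 hα
    have hα' : Summable fun j => α (j + 1) := (summable_nat_add_iff 1).2 hα
    have hcd := contDiff_smoothRamp_nat (n + 1) _ (fun j => h0 (j + 1)) hα'
    have h3 := ih (fun j => α (j + 1)) (fun j => h0 (j + 1)) hα'
    have h5 := h0 0
    have hadd : ContDiff ℝ (n + 1 : ℕ) fun x => smoothRamp (fun j => α (j + 1)) (x + α 0) :=
      hcd.comp (contDiff_id.add contDiff_const)
    have hsub : ContDiff ℝ (n + 1 : ℕ) fun x => smoothRamp (fun j => α (j + 1)) (x - α 0) :=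
      hcd.comp (contDiff_id.sub contDiff_const)
    rw [iteratedDeriv_succ', h2, iteratedDeriv_const_mul_field, iteratedDeriv_fun_sub
      hadd.contDiffAt hsub.contDiffAt,
      iteratedDeriv_comp_add_const, iteratedDeriv_comp_sub_const, abs_mul,
      abs_of_pos (by positivity), Finset.prod_range_succ', inv_mul_le_iff₀ (by positivity)]
    refine (abs_sub _ _).trans ?_
    refine (add_le_add (h3 _) (h3 _)).trans (le_of_eq ?_)
    field_simp
    ring

/-! ### Functions whose derivatives are controlled by a weight sequence -/

/-- The derivatives of the smooth function `f` are bounded on `ℝ` by a multiple of the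
weights `m`. -/
def DerivBounded (m : ℕ → ℝ) (f : ℝ → ℝ) : Prop :=
  ContDiff ℝ ∞ f ∧ ∃ A : ℝ, ∀ k x, |iteratedDeriv k f x| ≤ A * m k

/-- The derivatives of the smooth function `f` are bounded on every bounded set by a multiple of
the weights `m`. -/
def LocDerivBounded (m : ℕ → ℝ) (f : ℝ → ℝ) : Prop :=
  ContDiff ℝ ∞ f ∧ ∀ R : ℝ, ∃ A : ℝ, ∀ k x, |x| ≤ R → |iteratedDeriv k f x| ≤ A * m k

/-- The weights `m` admit, for every width `w`, a smooth ramp bending only in `(-w, w)` whose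
derivatives of positive order are bounded by a multiple of the weights. -/
def HasRamps (m : ℕ → ℝ) : Prop :=
  ∀ w : ℝ, 0 < w → ∃ ρ : ℝ → ℝ, IsRamp w ρ ∧ ContDiff ℝ ∞ ρ ∧
    ∃ A : ℝ, ∀ k x, |iteratedDeriv (k + 1) ρ x| ≤ A * m (k + 1)

/-- Dilating a ramp would multiply its `k`-th derivative by a `k`-th power and leave the weights.
Shrinking only the first `J` radii, where the tail beyond `J` is already short, costs just the
constant `θ⁻¹ ^ J`. -/
theorem exists_rescaled_summable {α : ℕ → ℝ} (h0 : ∀ j, 0 < α j) (hα : Summable α) {w : ℝ}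
    (hw : 0 < w) : ∃ α' : ℕ → ℝ, (∀ j, 0 < α' j) ∧ Summable α' ∧ ∑' j, α' j ≤ w ∧
      ∃ A : ℝ, 0 < A ∧ ∀ k, ∏ j ∈ Finset.range k, (α' j)⁻¹ ≤ A * ∏ j ∈ Finset.range k, (α j)⁻¹ := by
  obtain ⟨J, hJ⟩ := ((tendsto_sum_nat_add α).eventually_le_const
    (by positivity : (0 : ℝ) < w / 2)).exists
  set S : ℝ := ∑ j ∈ Finset.range J, α j with hS
  have hS0 : 0 ≤ S := Finset.sum_nonneg fun j _ => (h0 j).le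
  obtain ⟨θ, hθ0, hθ1, hθS⟩ : ∃ θ : ℝ, 0 < θ ∧ θ ≤ 1 ∧ θ * S ≤ w / 2 := by
    refine ⟨min 1 (w / 2 / (S + 1)), by positivity, min_le_left _ _, ?_⟩
    calc _ ≤ w / 2 / (S + 1) * S := by gcongr; exact min_le_right _ _
      _ ≤ w / 2 / (S + 1) * (S + 1) := by gcongr; linarith
      _ = w / 2 := by field_simp
  set α' : ℕ → ℝ := fun j => if j < J then θ * α j else α j with hα'
  have h0' : ∀ j, 0 < α' j := fun j => by
    have := h0 j
    simp only [hα']; split_ifs <;> positivity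
  have hle : ∀ j, α' j ≤ α j := fun j => by
    simp only [hα']; split_ifs
    · exact mul_le_of_le_one_left (h0 j).le hθ1
    · exact le_rfl
  have hsum' : Summable α' := Summable.of_nonneg_of_le (fun j => (h0' j).le) hle hα
  refine ⟨α', h0', hsum', ?_, (θ⁻¹) ^ J, by positivity, fun k => ?_⟩
  · rw [← hsum'.sum_add_tsum_nat_add J]
    have h1 : ∑ j ∈ Finset.range J, α' j = θ * S := by
      rw [hS, Finset.mul_sum]
      exact Finset.sum_congr rfl fun j hj => if_pos (Finset.mem_range.1 hj)
    have h2 : ∑' j, α' (j + J) = ∑' j, α (j + J) :=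
      tsum_congr fun j => if_neg (by omega)
    rw [h1, h2]
    linarith
  · have h1θ : 1 ≤ θ⁻¹ := (one_le_inv₀ hθ0).2 hθ1
    induction k with
    | zero => simpa using one_le_pow₀ h1θ
    | succ k ih =>
      rcases le_or_gt J k with hk | hk
      · rw [Finset.prod_range_succ, Finset.prod_range_succ, ← mul_assoc]
        have : α' k = α k := if_neg (by omega)
        rw [this]
        have := h0 k
        gcongr
      · have h2 : ∏ j ∈ Finset.range (k + 1), (α' j)⁻¹ =
            (θ⁻¹) ^ (k + 1) * ∏ j ∈ Finset.range (k + 1), (α j)⁻¹ := by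
          rw [← Finset.card_range (k + 1), ← Finset.prod_const, Finset.card_range,
            ← Finset.prod_mul_distrib]
          refine Finset.prod_congr rfl fun j hj => ?_
          have : α' j = θ * α j := if_pos (by rw [Finset.mem_range] at hj; omega)
          rw [this, mul_inv]
        rw [h2]
        refine mul_le_mul_of_nonneg_right (pow_le_pow_right₀ h1θ hk) ?_
        exact Finset.prod_nonneg fun j _ => (inv_pos.2 (h0 j)).le

theorem hasRamps_of_flat {f : ℝ → ℝ} (hf : ContDiff ℝ ∞ f) {a b : ℝ} {m : ℕ → ℝ}
    (hm : ∀ k, 0 < m k) (hab : a ≤ b) (hbd : ∀ k, ∀ x ∈ Set.Icc a b, |iteratedDeriv k f x| ≤ m k)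
    (ha : ∀ k, iteratedDeriv k f a = 0) (hb : f b ≠ 0) : HasRamps m := by
  obtain ⟨α, h0, hα, hle⟩ := exists_summable_minorant hf hm hab hbd ha hb
  intro w hw
  obtain ⟨α', h0', hα', hw', A, hA, hAle⟩ := exists_rescaled_summable h0 hα hw
  refine ⟨smoothRamp α', (isRamp_smoothRamp (fun j => (h0' j).le) hα').mono hw',
    contDiff_smoothRamp h0' hα', A * ((∑' j, α j) / m 0), fun k x => ?_⟩
  refine (abs_iteratedDeriv_smoothRamp_le k α' h0' hα' x).trans ((hAle k).trans ?_)
  rw [mul_assoc]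
  refine mul_le_mul_of_nonneg_left ?_ hA.le
  have hP : 0 ≤ ∏ j ∈ Finset.range k, (α j)⁻¹ := Finset.prod_nonneg fun j _ => (inv_pos.2 (h0 j)).le
  -- The derivative bound for order `k + 1` has one factor `(α k)⁻¹` fewer than the bound for `m (k
  -- + 1)`; the missing `α k` is absorbed by the total sum.
  have h1 : α k ≤ ∑' j, α j := hα.le_tsum k fun j _ => (h0 j).le
  have h2 := hle (k + 1)
  have hm0 := hm 0
  have hak := h0 k
  rw [div_mul_eq_mul_div, le_div_iff₀ hm0]
  calc _ = α k * (m 0 * ∏ j ∈ Finset.range (k + 1), (α j)⁻¹) := by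
        rw [Finset.prod_range_succ]; field_simp
    _ ≤ (∑' j, α j) * m (k + 1) :=
        mul_le_mul h1 h2 (mul_nonneg hm0.le (Finset.prod_nonneg fun j _ => (inv_pos.2 (h0 j)).le))
          (hak.le.trans h1)

theorem LocDerivBounded.mem_locDenjoyCarleman {M : ℕ → ℝ} (hM : ∀ k, 0 < M k) {β B : ℝ}
    (hβ : 0 < β) (hB : 0 < B) {f : ℝ → ℝ} (hf : LocDerivBounded (fun k => β * B ^ k * M k) f) :
    f ∈ locDenjoyCarleman M := by
  refine ⟨hf.1, fun a b hab => ⟨hf.1.contDiffOn, ?_⟩⟩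
  obtain ⟨A, hA⟩ := hf.2 (max |a| |b|)
  refine ⟨max A 1 * β, B, by positivity, hB, fun k x hx => ?_⟩
  rw [iteratedDerivWithin_eq_iteratedDeriv (uniqueDiffOn_Icc hab)
    (hf.1.contDiffAt.of_le (by exact_mod_cast le_top)) hx]
  refine (hA k x (abs_le_max_abs_abs hx.1 hx.2)).trans ?_
  have := hM k
  calc A * (β * B ^ k * M k) ≤ max A 1 * (β * B ^ k * M k) := by
        gcongr; exact le_max_left _ _
    _ = _ := by ring

/-- Absorbing the constants `β`, `B` of one flat function on one interval into `m k = β * B ^ k * M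
k` fixes a single weight sequence in which series can be summed. A nonzero value to the left of the
flat point is handled by reflection. -/
theorem exists_hasRamps {Γ : Set (ℝ → ℝ)} (hΓ : IsLocallyDenjoyCarlemanClass Γ)
    (hqa : ¬ IsQuasiAnalyticClass Γ) :
    ∃ m : ℕ → ℝ, (∀ k, 0 < m k) ∧ HasRamps m ∧ ∀ f, LocDerivBounded m f → f ∈ Γ := by
  obtain ⟨M, hM, rfl⟩ := hΓ
  rw [IsQuasiAnalyticClass] at hqa
  push Not at hqa
  obtain ⟨f, ⟨hf, hfb⟩, ⟨x₀, hx₀⟩, x, hx⟩ := hqa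
  have hne : x ≠ x₀ := by
    rintro rfl
    exact hx (by simpa using hx₀ 0)
  have hbound : ∀ a b, a < b → ∃ β B : ℝ, 0 < β ∧ 0 < B ∧
      ∀ k, ∀ y ∈ Set.Icc a b, |iteratedDeriv k f y| ≤ β * B ^ k * M k := by
    intro a b hab
    obtain ⟨-, β, B, hβ, hB, h⟩ := hfb a b hab
    refine ⟨β, B, hβ, hB, fun k y hy => ?_⟩
    rw [← iteratedDerivWithin_eq_iteratedDeriv (uniqueDiffOn_Icc hab)
      (hf.contDiffAt.of_le (by exact_mod_cast le_top)) hy]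
    exact h k y hy
  rcases hne.lt_or_gt with hlt | hlt
  · obtain ⟨β, B, hβ, hB, h⟩ := hbound x x₀ hlt
    refine ⟨fun k => β * B ^ k * M k, fun k => by have := hM k; positivity, ?_,
      fun g hg => hg.mem_locDenjoyCarleman hM hβ hB⟩
    refine hasRamps_of_flat (f := fun y => f (-y)) (a := -x₀) (b := -x) (hf.comp contDiff_neg)
      (fun k => by have := hM k; positivity) (by linarith) (fun k y hy => ?_) (fun k => ?_)
      (by simpa using hx)
    · rw [iteratedDeriv_comp_neg, smul_eq_mul, abs_mul, abs_pow, abs_neg, abs_one, one_pow, one_mul]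
      exact h k _ ⟨by linarith [hy.2], by linarith [hy.1]⟩
    · rw [iteratedDeriv_comp_neg, neg_neg, hx₀, smul_zero]
  · obtain ⟨β, B, hβ, hB, h⟩ := hbound x₀ x hlt
    exact ⟨fun k => β * B ^ k * M k, fun k => by have := hM k; positivity,
      hasRamps_of_flat hf (fun k => by have := hM k; positivity) hlt.le h hx₀ hx,
      fun g hg => hg.mem_locDenjoyCarleman hM hβ hB⟩

/-! ### Steps, series, and extension to increasing bijections -/

/-- The difference of two translates of one ramp; it is monotone because the ramp has monotone
increments. -/
theorem HasRamps.exists_step {m : ℕ → ℝ} (hr : HasRamps m) (hm : ∀ k, 0 < m k) {p q w : ℝ}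
    (hw : 0 < w) (hpq : p ≤ q) : ∃ U : ℝ → ℝ, DerivBounded m U ∧ Monotone U ∧
      (∀ x, x ≤ p - w → U x = 0) ∧ (∀ x, q + w ≤ x → U x = q - p) ∧
      ∀ x, p + w ≤ x → x ≤ q - w → U x = x - p := by
  obtain ⟨ρ, hρ, hρc, A, hA⟩ := hr w hw
  have hc1 : ContDiff ℝ ∞ fun x => ρ (x - p) := hρc.comp (contDiff_id.sub contDiff_const)
  have hc2 : ContDiff ℝ ∞ fun x => ρ (x - q) := hρc.comp (contDiff_id.sub contDiff_const)
  refine ⟨fun x => ρ (x - p) - ρ (x - q), ⟨hc1.sub hc2, max (|q - p| / m 0) (2 * A), ?_⟩,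
    fun x y hxy => ?_, fun x hx => ?_, fun x hx => ?_, fun x hx hx' => ?_⟩
  · intro k x
    rcases k with _ | k
    · rw [iteratedDeriv_zero]
      calc _ ≤ |q - p| := by simpa using hρ.lip (x - p) (x - q)
        _ = |q - p| / m 0 * m 0 := by have := (hm 0).ne'; field_simp
        _ ≤ _ := mul_le_mul_of_nonneg_right (le_max_left _ _) (hm 0).le
    · rw [iteratedDeriv_fun_sub (hc1.of_le (by exact_mod_cast le_top)).contDiffAt
        (hc2.of_le (by exact_mod_cast le_top)).contDiffAt, iteratedDeriv_comp_sub_const,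
        iteratedDeriv_comp_sub_const]
      calc _ ≤ A * m (k + 1) + A * m (k + 1) :=
            (abs_sub _ _).trans (add_le_add (hA k _) (hA k _))
        _ = 2 * A * m (k + 1) := by ring
        _ ≤ _ := mul_le_mul_of_nonneg_right (le_max_right _ _) (hm _).le
  · have := hρ.incr (q - p) (by linarith) (x - q) (y - q) (by linarith)
    simpa using this
  · simp only; rw [hρ.left _ (by linarith), hρ.left _ (by linarith), sub_zero]
  · simp only; rw [hρ.right _ (by linarith), hρ.right _ (by linarith)]; ring
  · simp only; rw [hρ.right _ (by linarith), hρ.left _ (by linarith), sub_zero]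

theorem DerivBounded.locDerivBounded {m : ℕ → ℝ} {f : ℝ → ℝ} (hf : DerivBounded m f) :
    LocDerivBounded m f :=
  ⟨hf.1, fun _ => ⟨hf.2.choose, fun k x _ => hf.2.choose_spec k x⟩⟩

theorem LocDerivBounded.add {m : ℕ → ℝ} {f g : ℝ → ℝ} (hf : LocDerivBounded m f)
    (hg : LocDerivBounded m g) : LocDerivBounded m fun x => f x + g x := by
  refine ⟨hf.1.add hg.1, fun R => ?_⟩
  obtain ⟨A, hA⟩ := hf.2 R
  obtain ⟨B, hB⟩ := hg.2 R
  refine ⟨A + B, fun k x hx => ?_⟩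
  rw [iteratedDeriv_fun_add (hf.1.of_le (by exact_mod_cast le_top)).contDiffAt
    (hg.1.of_le (by exact_mod_cast le_top)).contDiffAt, add_mul]
  exact (abs_add_le _ _).trans (add_le_add (hA k x hx) (hB k x hx))

theorem LocDerivBounded.neg {m : ℕ → ℝ} {f : ℝ → ℝ} (hf : LocDerivBounded m f) :
    LocDerivBounded m fun x => -f x := by
  refine ⟨hf.1.neg, fun R => ?_⟩
  obtain ⟨A, hA⟩ := hf.2 R
  refine ⟨A, fun k x hx => ?_⟩
  rw [iteratedDeriv_fun_neg, abs_neg]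
  exact hA k x hx

theorem LocDerivBounded.comp_neg {m : ℕ → ℝ} {f : ℝ → ℝ} (hf : LocDerivBounded m f) :
    LocDerivBounded m fun x => f (-x) := by
  refine ⟨hf.1.comp contDiff_neg, fun R => ?_⟩
  obtain ⟨A, hA⟩ := hf.2 R
  refine ⟨A, fun k x hx => ?_⟩
  rw [iteratedDeriv_comp_neg, smul_eq_mul, abs_mul, abs_pow, abs_neg, abs_one, one_pow, one_mul]
  exact hA k (-x) (by simpa using hx)

theorem LocDerivBounded.comp_sub_const {m : ℕ → ℝ} {f : ℝ → ℝ} (hf : LocDerivBounded m f)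
    (c : ℝ) : LocDerivBounded m fun x => f (x - c) := by
  refine ⟨hf.1.comp (contDiff_id.sub contDiff_const), fun R => ?_⟩
  obtain ⟨A, hA⟩ := hf.2 (R + |c|)
  refine ⟨A, fun k x hx => ?_⟩
  rw [iteratedDeriv_comp_sub_const]
  exact hA k _ ((abs_sub _ _).trans (by linarith))

theorem derivBounded_const {m : ℕ → ℝ} (hm : ∀ k, 0 < m k) (c : ℝ) :
    DerivBounded m fun _ => c := by
  refine ⟨contDiff_const, |c| / m 0, fun k x => ?_⟩
  have h0 := hm 0
  have hk := hm k
  rw [iteratedDeriv_const]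
  split_ifs with h
  · rw [h]; field_simp; exact le_rfl
  · rw [abs_zero]; positivity

theorem DerivBounded.add {m : ℕ → ℝ} {f g : ℝ → ℝ} (hf : DerivBounded m f)
    (hg : DerivBounded m g) : DerivBounded m fun x => f x + g x := by
  obtain ⟨hf, A, hA⟩ := hf
  obtain ⟨hg, B, hB⟩ := hg
  refine ⟨hf.add hg, A + B, fun k x => ?_⟩
  rw [iteratedDeriv_fun_add (hf.of_le (by exact_mod_cast le_top)).contDiffAt
    (hg.of_le (by exact_mod_cast le_top)).contDiffAt, add_mul]
  exact (abs_add_le _ _).trans (add_le_add (hA k x) (hB k x))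

theorem DerivBounded.const_mul {m : ℕ → ℝ} {f : ℝ → ℝ} (hf : DerivBounded m f) (c : ℝ) :
    DerivBounded m fun x => c * f x := by
  obtain ⟨hf, A, hA⟩ := hf
  refine ⟨contDiff_const.mul hf, |c| * A, fun k x => ?_⟩
  rw [iteratedDeriv_const_mul_field, abs_mul, mul_assoc]
  exact mul_le_mul_of_nonneg_left (hA k x) (abs_nonneg c)

theorem DerivBounded.comp_sub_const {m : ℕ → ℝ} {f : ℝ → ℝ} (hf : DerivBounded m f) (c : ℝ) :
    DerivBounded m fun x => f (x - c) := by
  obtain ⟨hf, A, hA⟩ := hf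
  refine ⟨hf.comp (contDiff_id.sub contDiff_const), A, fun k x => ?_⟩
  rw [iteratedDeriv_comp_sub_const]
  exact hA k _

theorem DerivBounded.sum {m : ℕ → ℝ} (hm : ∀ k, 0 < m k) {ι : Type*} {f : ι → ℝ → ℝ} (s : Finset ι)
    (hf : ∀ i, DerivBounded m (f i)) : DerivBounded m fun x => ∑ i ∈ s, f i x := by
  classical
  induction s using Finset.induction_on with
  | empty => simpa using derivBounded_const hm 0
  | insert i s hi ih =>
    simp only [Finset.sum_insert hi]
    exact (hf i).add ih

theorem DerivBounded.tsum {m : ℕ → ℝ} {f : ℕ → ℝ → ℝ} {A c : ℕ → ℝ}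
    (hf : ∀ i, ContDiff ℝ ∞ (f i)) (hA : ∀ i k x, |iteratedDeriv k (f i) x| ≤ A i * m k)
    (hc : ∀ i, 0 ≤ c i) (hs : Summable fun i => c i * A i) :
    DerivBounded m (fun x => ∑' i, c i * f i x) ∧ ∀ x, Summable fun i => c i * f i x := by
  have hb : ∀ i k x, |iteratedDeriv k (fun x => c i * f i x) x| ≤ c i * A i * m k := by
    intro i k x
    rw [iteratedDeriv_const_mul_field, abs_mul, abs_of_nonneg (hc i), mul_assoc]
    exact mul_le_mul_of_nonneg_left (hA i k x) (hc i)
  have hcf : ∀ i, ContDiff ℝ ∞ fun x => c i * f i x := fun i => contDiff_const.mul (hf i)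
  refine ⟨⟨?_, ∑' i, c i * A i, fun k x => ?_⟩, fun x => ?_⟩
  · exact contDiff_tsum hcf (fun k hk => hs.mul_right (m k)) fun k i x hk => by
      rw [norm_iteratedFDeriv_eq_norm_iteratedDeriv]
      exact hb i k x
  · rw [← Real.norm_eq_abs, ← norm_iteratedFDeriv_eq_norm_iteratedDeriv,
      iteratedFDeriv_tsum_apply (N := ⊤) hcf (fun k hk => hs.mul_right (m k)) (fun k i x hk => by
        rw [norm_iteratedFDeriv_eq_norm_iteratedDeriv]
        exact hb i k x) le_top, ← tsum_mul_right]
    refine tsum_of_norm_bounded (hs.mul_right (m k)).hasSum fun i => ?_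
    rw [norm_iteratedFDeriv_eq_norm_iteratedDeriv]
    exact hb i k x
  · refine Summable.of_norm_bounded (hs.mul_right (m 0)) fun i => ?_
    have := hb i 0 x
    rwa [iteratedDeriv_zero] at this

theorem monotone_tsum_mul {f : ℕ → ℝ → ℝ} {c : ℕ → ℝ} (hf : ∀ i, Monotone (f i))
    (hc : ∀ i, 0 ≤ c i) (hs : ∀ x, Summable fun i => c i * f i x) :
    Monotone fun x => ∑' i, c i * f i x := fun x y hxy =>
  (hs x).tsum_le_tsum (fun i => mul_le_mul_of_nonneg_left (hf i hxy) (hc i)) (hs y)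

theorem tsum_mul_lt_tsum_mul {f : ℕ → ℝ → ℝ} {c : ℕ → ℝ} (hf : ∀ i, Monotone (f i))
    (hc : ∀ i, 0 ≤ c i) (hs : ∀ x, Summable fun i => c i * f i x) {x y : ℝ} (hxy : x ≤ y) {i : ℕ}
    (hi : f i x < f i y) (hci : 0 < c i) : ∑' i, c i * f i x < ∑' i, c i * f i y :=
  Summable.tsum_lt_tsum (i := i) (fun i => mul_le_mul_of_nonneg_left (hf i hxy) (hc i))
    (mul_lt_mul_of_pos_left hi hci) (hs x) (hs y)

/-- Serves to modify a function beyond the endpoint of an interval without touching it inside. A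
translated ramp gives linear growth; a series of steps starting ever closer to 0 gives strict
increase immediately to the right of 0. -/
theorem HasRamps.exists_flat_growing {m : ℕ → ℝ} (hr : HasRamps m) (hm : ∀ k, 0 < m k) :
    ∃ E : ℝ → ℝ, LocDerivBounded m E ∧ Monotone E ∧ (∀ x ≤ 0, E x = 0) ∧
      (∀ x y, x < y → 0 < y → E x < E y) ∧ ∀ x, x - 1 ≤ E x := by
  obtain ⟨ρ, hρ, hρc, A₀, hA₀⟩ := hr (1 / 2) (by norm_num)
  -- The `n`-th step has slope 1 on `[2 * (1 / 2) ^ n, 3 - (1 / 2) ^ n]`, so the steps jointly cover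
  -- `(0, 2]`; from 1 on the ramp is strictly increasing.
  have hstep := fun n : ℕ => hr.exists_step hm (p := (1 / 2) ^ n) (q := 3) (w := (1 / 2) ^ n)
    (by positivity) ((pow_le_one₀ (by norm_num) (by norm_num)).trans (by norm_num))
  choose U hU hUm hU0 hU1 hUa using hstep
  choose hUc A hA using hU
  have hA0 : ∀ n, 0 ≤ A n := fun n =>
    nonneg_of_mul_nonneg_left ((abs_nonneg _).trans (hA n 0 0)) (hm 0)
  set c : ℕ → ℝ := fun n => (1 / 2) ^ n / (A n + 1) with hcdef
  have hc : ∀ n, 0 < c n := fun n => by have := hA0 n; positivity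
  have hs : Summable fun n => c n * A n := by
    refine Summable.of_nonneg_of_le (fun n => mul_nonneg (hc n).le (hA0 n)) (fun n => ?_)
      summable_geometric_two
    have := hA0 n
    rw [hcdef]
    simp only
    rw [div_mul_eq_mul_div, div_le_iff₀ (by positivity)]
    gcongr
    linarith
  obtain ⟨hG, hGs⟩ := DerivBounded.tsum hUc hA (fun n => (hc n).le) hs
  have hGm := monotone_tsum_mul hUm (fun n => (hc n).le) hGs
  have hρm : Monotone ρ := by
    intro x y hxy
    -- An increment of the same length far to the left is zero, and increments can only grow to the
    -- right.
    have h := hρ.incr (y - x) (by linarith) (min x (-(1 / 2) - (y - x))) x (min_le_left _ _)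
    have h3 := min_le_right x (-(1 / 2) - (y - x))
    rw [hρ.left (min x (-(1 / 2) - (y - x))) (by linarith),
      hρ.left (min x (-(1 / 2) - (y - x)) + (y - x)) (by linarith)] at h
    simp only [sub_self, add_sub_cancel] at h
    linarith
  have hU0' : ∀ n x, x ≤ 0 → U n x = 0 := fun n x hx => hU0 n x (by simpa using hx)
  have hGnn : ∀ x, 0 ≤ ∑' n, c n * U n x := by
    intro x
    refine tsum_nonneg fun n => mul_nonneg (hc n).le ?_
    rw [← hU0' n (min x 0) (min_le_right _ _)]
    exact hUm n (min_le_left _ _)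
  refine ⟨fun x => ρ (x - 1 / 2) + ∑' n, c n * U n x, ?_, ?_, ?_, ?_, ?_⟩
  · refine LocDerivBounded.add (LocDerivBounded.comp_sub_const (f := ρ) ⟨hρc, fun R => ?_⟩ _)
      hG.locDerivBounded
    refine ⟨max ((|R| + 1) / m 0) A₀, fun k x hx => ?_⟩
    rcases k with _ | k
    · rw [iteratedDeriv_zero]
      have h1 := hρ.lip x (-(1 / 2))
      rw [hρ.left _ le_rfl, sub_zero] at h1
      have h2 : |x - -(1 / 2)| ≤ |x| + 1 := by
        refine (abs_sub _ _).trans ?_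
        rw [abs_neg, abs_of_pos (by norm_num : (0 : ℝ) < 1 / 2)]
        linarith
      calc _ ≤ |R| + 1 := by linarith [le_abs_self R]
        _ = (|R| + 1) / m 0 * m 0 := by have := (hm 0).ne'; field_simp
        _ ≤ _ := mul_le_mul_of_nonneg_right (le_max_left _ _) (hm 0).le
    · exact (hA₀ k x).trans (mul_le_mul_of_nonneg_right (le_max_right _ _) (hm _).le)
  · exact fun x y hxy => add_le_add (hρm (by linarith)) (hGm hxy)
  · intro x hx
    simp only
    rw [hρ.left _ (by linarith), tsum_congr fun n => by rw [hU0' n x hx, mul_zero]]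
    simp
  · intro x y hxy hy
    simp only
    rcases le_or_gt 1 x with hx | hx
    · refine add_lt_add_of_lt_of_le ?_ (hGm hxy.le)
      rw [hρ.right _ (by linarith), hρ.right _ (by linarith)]
      linarith
    · refine add_lt_add_of_le_of_lt (hρm (by linarith)) ?_
      set y' := min y 2
      have hxy' : x < y' := lt_min hxy (by linarith)
      have hy' : 0 < y' := lt_min hy (by norm_num)
      refine lt_of_lt_of_le ?_ (hGm (min_le_left y 2))
      obtain ⟨n, hn⟩ := exists_pow_lt_of_lt_one (by positivity : 0 < y' / 2)
        (by norm_num : (1 / 2 : ℝ) < 1)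
      have hp1 : (1 / 2 : ℝ) ^ n ≤ 1 := pow_le_one₀ (by norm_num) (by norm_num)
      refine tsum_mul_lt_tsum_mul hUm (fun n => (hc n).le) hGs hxy'.le (i := n) ?_ (hc n)
      have h2 : y' ≤ 2 := min_le_right _ _
      have hyU := hUa n y' (by linarith) (by linarith)
      have hxU : U n x ≤ U n (max x (2 * (1 / 2) ^ n)) := hUm n (le_max_left _ _)
      rw [hUa n (max x (2 * (1 / 2) ^ n)) ((le_of_eq (by ring)).trans (le_max_right _ _))
        ((max_le hxy'.le (by linarith)).trans (by linarith))] at hxU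
      have : max x (2 * (1 / 2) ^ n) < y' := max_lt hxy' (by linarith)
      linarith
  · intro x
    simp only
    have := hGnn x
    rcases le_or_gt 1 x with hx | hx
    · rw [hρ.right _ (by linarith)]; linarith
    · have : 0 ≤ ρ (x - 1 / 2) := by
        rw [← hρ.left (min (x - 1 / 2) (-(1 / 2))) (min_le_right _ _)]
        exact hρm (min_le_left _ _)
      linarith

/-- Since `g` is bounded, adding `E (x - b)` and `-E (a - x)` makes it strictly increasing and onto
without changing it on `[a, b]`. -/
theorem HasRamps.exists_orderIso {m : ℕ → ℝ} (hr : HasRamps m) (hm : ∀ k, 0 < m k) {g : ℝ → ℝ}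
    (hg : DerivBounded m g) (hgm : Monotone g) {a b : ℝ}
    (hs : StrictMonoOn g (Set.Icc a b)) :
    ∃ φ : ℝ ≃o ℝ, LocDerivBounded m φ ∧ ∀ x ∈ Set.Icc a b, φ x = g x := by
  obtain ⟨E, hE, hEm, hE0, hEs, hEg⟩ := hr.exists_flat_growing hm
  obtain ⟨A, hA⟩ := hg.2
  have hgb : ∀ x, |g x| ≤ A * m 0 := fun x => by simpa using hA 0 x
  set F : ℝ → ℝ := fun x => g x + (E (x - b) + -E (-(x - a))) with hF
  have hFb : LocDerivBounded m F :=
    hg.locDerivBounded.add ((hE.comp_sub_const b).add ((hE.comp_neg).comp_sub_const a).neg)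
  have hstrict : StrictMono F := by
    intro x y hxy
    have h1 := hgm hxy.le
    have h2 : E (x - b) ≤ E (y - b) := hEm (by linarith)
    have h3 : E (-(y - a)) ≤ E (-(x - a)) := hEm (by linarith)
    simp only [hF]
    by_cases hx : a ≤ x
    · by_cases hy : y ≤ b
      · have := hs ⟨hx, hxy.le.trans hy⟩ ⟨hx.trans hxy.le, hy⟩ hxy
        linarith
      · have := hEs (x - b) (y - b) (by linarith) (by linarith)
        linarith
    · have := hEs (-(y - a)) (-(x - a)) (by linarith) (by linarith)
      linarith
  have htop : Filter.Tendsto F Filter.atTop Filter.atTop := by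
    refine Filter.tendsto_atTop_mono' _ ?_
      (Filter.tendsto_atTop_add_const_right _ (-b - 1 - A * m 0) Filter.tendsto_id)
    filter_upwards [Filter.eventually_ge_atTop a] with x hx
    have h1 := hEg (x - b)
    have h2 := hE0 (-(x - a)) (by linarith)
    have h3 := (abs_le.1 (hgb x)).1
    simp only [hF, id]
    linarith
  have hbot : Filter.Tendsto F Filter.atBot Filter.atBot := by
    refine Filter.tendsto_atBot_mono' _ ?_
      (Filter.tendsto_atBot_add_const_right _ (-a + 1 + A * m 0) Filter.tendsto_id)
    filter_upwards [Filter.eventually_le_atBot b] with x hx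
    have h1 := hEg (-(x - a))
    have h2 := hE0 (x - b) (by linarith)
    have h3 := (abs_le.1 (hgb x)).2
    simp only [hF, id]
    linarith
  refine ⟨StrictMono.orderIsoOfSurjective F hstrict (hFb.1.continuous.surjective htop hbot),
    hFb, fun x hx => ?_⟩
  change F x = g x
  simp only [hF]
  rw [hE0 (x - b) (by linarith [hx.2]), hE0 (-(x - a)) (by linarith [hx.1])]
  ring

/-! ### A self-similar labelling of the Cantor set with base-`4` digits `0` and `3` -/

/-- The `i`-th digit after the point in the base-`4` expansion of `t`. -/
noncomputable def quaternaryDigit (i : ℕ) (t : ℝ) : ℤ := ⌊4 ^ (i + 1) * t⌋ % 4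

open Classical in
/-- The indicator function of the points of `[0, 1)` all of whose base-`4` digits are `0` or `3`,
the digit `3` occurring at infinitely many even and infinitely many odd positions. -/
noncomputable def cantorLabel (t : ℝ) : ℝ :=
  if 0 ≤ t ∧ t < 1 ∧ (∀ i, quaternaryDigit i t = 0 ∨ quaternaryDigit i t = 3) ∧
      (∀ K, ∃ i ≥ K, Even i ∧ quaternaryDigit i t = 3) ∧
      (∀ K, ∃ i ≥ K, Odd i ∧ quaternaryDigit i t = 3) then 1 else 0

theorem quaternaryDigit_succ (c : ℤ) (y : ℝ) (i : ℕ) :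
    quaternaryDigit (i + 1) ((c + y) / 4) = quaternaryDigit i y := by
  have h : (4 : ℝ) ^ (i + 1 + 1) * ((c + y) / 4) = ((4 ^ i * c * 4 : ℤ) : ℝ) + 4 ^ (i + 1) * y := by
    push_cast; ring
  rw [quaternaryDigit, quaternaryDigit, h, Int.floor_intCast_add, Int.mul_add_emod_self_right]

theorem quaternaryDigit_zero {c : ℤ} {z : ℝ} (h1 : c ≤ 4 * z) (h2 : 4 * z < c + 1) :
    quaternaryDigit 0 z = c % 4 := by
  have : ⌊4 * z⌋ = c := Int.floor_eq_iff.2 ⟨h1, h2⟩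
  simp [quaternaryDigit, this]

theorem quaternaryDigit_div_pow (i : ℕ) (j : ℕ) : ∀ y : ℝ,
    quaternaryDigit (j + i) (y / 4 ^ j) = quaternaryDigit i y := by
  induction j with
  | zero => intro y; simp
  | succ j ih =>
    intro y
    have := quaternaryDigit_succ 0 (y / 4 ^ j) (j + i)
    rw [ih, Int.cast_zero, zero_add, div_div, ← pow_succ] at this
    rw [← this]
    congr 1
    ring

theorem cantorLabel_of_neg {t : ℝ} (h : t < 0) : cantorLabel t = 0 :=
  if_neg fun H => absurd H.1 (by linarith)

/-- Prepending a digit shifts every position by one and so exchanges the two parity conditions; as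
both are required, the label is unchanged. -/
theorem cantorLabel_child {c : ℤ} (hc : c = 0 ∨ c = 3) {y : ℝ} (h0 : 0 ≤ y) (h1 : y < 1) :
    cantorLabel ((c + y) / 4) = cantorLabel y := by
  have hz : quaternaryDigit 0 ((c + y) / 4) = c := by
    rw [quaternaryDigit_zero (c := c) (by linarith) (by linarith)]
    rcases hc with rfl | rfl <;> rfl
  have hs := quaternaryDigit_succ c y
  have hc0 : (0 : ℝ) ≤ c ∧ (c : ℝ) ≤ 3 := by rcases hc with rfl | rfl <;> norm_num
  unfold cantorLabel
  congr 1
  refine propext ⟨fun ⟨_, _, hd, he, ho⟩ => ⟨h0, h1, fun i => ?_, fun K => ?_, fun K => ?_⟩,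
    fun ⟨_, _, hd, he, ho⟩ => ⟨by linarith [hc0.1], by linarith [hc0.2], fun i => ?_, fun K => ?_,
      fun K => ?_⟩⟩
  · rw [← hs]; exact hd (i + 1)
  · obtain ⟨i, hi, hp, hi3⟩ := ho (K + 1)
    obtain ⟨i, rfl⟩ : ∃ j, i = j + 1 := ⟨i - 1, by omega⟩
    exact ⟨i, by omega, by simpa [Nat.odd_add_one] using hp, by rw [← hs, hi3]⟩
  · obtain ⟨i, hi, hp, hi3⟩ := he (K + 1)
    obtain ⟨i, rfl⟩ : ∃ j, i = j + 1 := ⟨i - 1, by omega⟩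
    exact ⟨i, by omega, by simpa [Nat.even_add_one] using hp, by rw [← hs, hi3]⟩
  · rcases i with _ | i
    · rw [hz]; exact hc
    · rw [hs]; exact hd i
  · obtain ⟨i, hi, hp, hi3⟩ := ho K
    exact ⟨i + 1, by omega, by simpa [Nat.even_add_one] using hp, by rw [hs, hi3]⟩
  · obtain ⟨i, hi, hp, hi3⟩ := he K
    exact ⟨i + 1, by omega, hp.add_one, by rw [hs, hi3]⟩

theorem cantorLabel_of_middle {z : ℝ} (h1 : 1 / 4 ≤ z) (h2 : z < 3 / 4) : cantorLabel z = 0 := by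
  refine if_neg fun ⟨_, _, hd, _⟩ => ?_
  have := hd 0
  rcases lt_or_ge z (1 / 2) with h | h
  · rw [quaternaryDigit_zero (c := 1) (by push_cast; linarith) (by push_cast; linarith)] at this
    norm_num at this
  · rw [quaternaryDigit_zero (c := 2) (by push_cast; linarith) (by push_cast; linarith)] at this
    norm_num at this

theorem cantorLabel_div_pow {y : ℝ} (h0 : 0 ≤ y) (h1 : y < 1) (j : ℕ) :
    cantorLabel (y / 4 ^ j) = cantorLabel y := by
  induction j with
  | zero => simp
  | succ j ih =>
    rw [← ih, ← cantorLabel_child (c := 0) (Or.inl rfl) (y := y / 4 ^ j) (by positivity)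
      ((div_le_self h0 (one_le_pow₀ (by norm_num))).trans_lt h1)]
    congr 1
    push_cast
    ring

/-- The partial sums of the number with base-`4` digits `3` at the positions `k 0, k 1, ...`. -/
noncomputable def cantorPartial (k : ℕ → ℕ) (n : ℕ) : ℝ :=
  ∑ m ∈ Finset.range n, 3 / 4 ^ (k m + 1)

/-- The number with base-`4` digits `3` at the positions `k 0, k 1, ...` and `0` elsewhere. -/
noncomputable def cantorPoint (k : ℕ → ℕ) : ℝ := ∑' m, 3 / 4 ^ (k m + 1)

theorem cantorPartial_succ (k : ℕ → ℕ) (n : ℕ) :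
    cantorPartial k (n + 1) = cantorPartial k n + 3 / 4 ^ (k n + 1) :=
  Finset.sum_range_succ _ _

theorem cantorPartial_succ_add (k : ℕ → ℕ) (n : ℕ) {j : ℕ} (hj : k n < j) (y : ℝ) :
    cantorPartial k (n + 1) + y / 4 ^ j =
      cantorPartial k n + ((3 : ℤ) + y / 4 ^ (j - (k n + 1))) / 4 / 4 ^ k n := by
  obtain ⟨d, rfl⟩ : ∃ d, j = k n + 1 + d := ⟨j - (k n + 1), by omega⟩
  rw [cantorPartial_succ, Nat.add_sub_cancel_left]
  push_cast
  field_simp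
  ring

theorem cantorLabel_partial_add {k : ℕ → ℕ} (hk : StrictMono k) (n : ℕ) :
    ∀ (y : ℝ) (j : ℕ), 0 ≤ y → y < 1 → (∀ i < n, k i < j) →
      cantorLabel (cantorPartial k n + y / 4 ^ j) = cantorLabel y := by
  induction n with
  | zero => intro y j h0 h1 _; simpa [cantorPartial] using cantorLabel_div_pow h0 h1 j
  | succ n ih =>
    intro y j h0 h1 hj
    have hy' : 0 ≤ y / 4 ^ (j - (k n + 1)) := by positivity
    have hy1 : y / 4 ^ (j - (k n + 1)) < 1 :=
      (div_le_self h0 (one_le_pow₀ (by norm_num))).trans_lt h1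
    rw [cantorPartial_succ_add k n (hj n (Nat.lt_succ_self n)) y,
      ih _ _ (by push_cast; positivity) (by push_cast; linarith) (fun i hi => hk hi),
      cantorLabel_child (Or.inr rfl) hy' hy1, cantorLabel_div_pow h0 h1]

theorem quaternaryDigit_partial_add {k : ℕ → ℕ} (hk : StrictMono k) (n : ℕ) :
    ∀ (y : ℝ) (i j : ℕ), (∀ i < n, k i < j) →
      quaternaryDigit (j + i) (cantorPartial k n + y / 4 ^ j) = quaternaryDigit i y := by
  induction n with
  | zero => intro y i j _; simpa [cantorPartial] using quaternaryDigit_div_pow i j y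
  | succ n ih =>
    intro y i j hj
    have hlt := hj n (Nat.lt_succ_self n)
    rw [cantorPartial_succ_add k n hlt y,
      show j + i = k n + ((j - (k n + 1) + i) + 1) by omega,
      ih _ _ _ (fun i hi => hk hi), quaternaryDigit_succ, quaternaryDigit_div_pow]

theorem strictMono_of_add_two_le {k : ℕ → ℕ} (hk : ∀ n, k n + 2 ≤ k (n + 1)) : StrictMono k :=
  strictMono_nat_of_lt_succ fun n => by have := hk n; omega

/-- `4 / 5 = ∑ 3 / 4 ^ (2 * i + 1)` is the largest tail possible, with a digit 3 at every second
position. Being below 1 it leaves the earlier digits unaffected. -/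
theorem antitone_cantorPartial_add {k : ℕ → ℕ} (hk : ∀ n, k n + 2 ≤ k (n + 1)) :
    Antitone fun n => cantorPartial k n + 4 / 5 / 4 ^ k n := by
  refine antitone_nat_of_succ_le fun n => ?_
  obtain ⟨d, hd⟩ : ∃ d, k (n + 1) = k n + 2 + d := ⟨k (n + 1) - (k n + 2), by have := hk n; omega⟩
  rw [cantorPartial_succ, hd, add_assoc]
  refine add_le_add le_rfl ?_
  have h1 : (1 : ℝ) ≤ 4 ^ d := one_le_pow₀ (by norm_num)
  have h4 : (0 : ℝ) < 4 ^ k n := by positivity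
  rw [pow_succ, pow_add, pow_add]
  have : (4 / 5 : ℝ) / (4 ^ k n * 4 ^ 2 * 4 ^ d) ≤ 4 / 5 / (4 ^ k n * 4 ^ 2) :=
    div_le_div_of_nonneg_left (by norm_num) (by positivity)
      (le_mul_of_one_le_right (by positivity) h1)
  calc _ ≤ 3 / (4 ^ k n * 4) + 4 / 5 / (4 ^ k n * 4 ^ 2) := add_le_add le_rfl this
    _ = 4 / 5 / 4 ^ k n := by field_simp; norm_num

theorem summable_cantorPoint {k : ℕ → ℕ} (hk : ∀ n, k n + 2 ≤ k (n + 1)) :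
    Summable fun m => (3 : ℝ) / 4 ^ (k m + 1) := by
  refine Summable.of_nonneg_of_le (fun m => by positivity) (fun m => ?_)
    ((summable_geometric_of_lt_one (by norm_num) (by norm_num : (1 / 4 : ℝ) < 1)).mul_left 3)
  rw [one_div, inv_pow, ← div_eq_mul_inv]
  have := (strictMono_of_add_two_le hk).id_le m
  gcongr
  · norm_num
  · simp only [id] at this; omega

theorem tendsto_cantorPartial {k : ℕ → ℕ} (hk : ∀ n, k n + 2 ≤ k (n + 1)) :
    Filter.Tendsto (cantorPartial k) Filter.atTop (nhds (cantorPoint k)) :=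
  (summable_cantorPoint hk).hasSum.tendsto_sum_nat

theorem cantorPartial_le_cantorPoint {k : ℕ → ℕ} (hk : ∀ n, k n + 2 ≤ k (n + 1)) (n : ℕ) :
    cantorPartial k n ≤ cantorPoint k :=
  (summable_cantorPoint hk).sum_le_tsum _ fun m _ => by positivity

theorem cantorPoint_le {k : ℕ → ℕ} (hk : ∀ n, k n + 2 ≤ k (n + 1)) (n : ℕ) :
    cantorPoint k ≤ cantorPartial k n + 4 / 5 / 4 ^ k n := by
  refine le_of_tendsto (tendsto_cantorPartial hk) ?_
  filter_upwards [Filter.eventually_ge_atTop n] with N hN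
  have h1 := antitone_cantorPartial_add hk hN
  have h2 : (0 : ℝ) ≤ 4 / 5 / 4 ^ k N := by positivity
  simp only at h1
  linarith

theorem quaternaryDigit_cantorPoint_self {k : ℕ → ℕ} (hk : ∀ n, k n + 2 ≤ k (n + 1)) (n : ℕ) :
    quaternaryDigit (k n) (cantorPoint k) = 3 := by
  have hmono := strictMono_of_add_two_le hk
  have h4 : (0 : ℝ) < 4 ^ k n := by positivity
  obtain ⟨z, hz⟩ : ∃ z, cantorPoint k = cantorPartial k n + z / 4 ^ k n :=
    ⟨(cantorPoint k - cantorPartial k n) * 4 ^ k n, by field_simp; ring⟩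
  have h1 := cantorPartial_le_cantorPoint hk (n + 1)
  have h2 := cantorPoint_le hk n
  rw [cantorPartial_succ, hz, add_le_add_iff_left, pow_succ,
    div_mul_eq_div_div_swap, div_le_div_iff_of_pos_right h4] at h1
  rw [hz, add_le_add_iff_left, div_le_div_iff_of_pos_right h4] at h2
  have := quaternaryDigit_partial_add hmono n z 0 (k n) fun i hi => hmono hi
  rw [add_zero] at this
  rw [hz, this, quaternaryDigit_zero (c := 3) (by push_cast; linarith) (by push_cast; linarith)]
  rfl

theorem quaternaryDigit_cantorPoint_of_ne {k : ℕ → ℕ} (hk : ∀ n, k n + 2 ≤ k (n + 1)) {i : ℕ}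
    (hi : ∀ n, k n ≠ i) : quaternaryDigit i (cantorPoint k) = 0 := by
  classical
  have hmono := strictMono_of_add_two_le hk
  have hex : ∃ n, i < k n := ⟨i + 1, hmono.id_le (i + 1)⟩
  obtain ⟨n, hn, hmin⟩ : ∃ n, i < k n ∧ ∀ l < n, k l < i :=
    ⟨Nat.find hex, Nat.find_spec hex, fun l hl =>
      lt_of_le_of_ne (not_lt.1 (Nat.find_min hex hl)) (hi l)⟩
  have h4 : (0 : ℝ) < 4 ^ i := by positivity
  obtain ⟨z, hz⟩ : ∃ z, cantorPoint k = cantorPartial k n + z / 4 ^ i :=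
    ⟨(cantorPoint k - cantorPartial k n) * 4 ^ i, by field_simp; ring⟩
  have h1 := cantorPartial_le_cantorPoint hk n
  have h2 := cantorPoint_le hk n
  have h3 : (4 / 5 : ℝ) / 4 ^ k n ≤ 1 / 5 / 4 ^ i := by
    calc (4 / 5 : ℝ) / 4 ^ k n ≤ 4 / 5 / 4 ^ (i + 1) := by
          gcongr
          · norm_num
          · omega
      _ = 1 / 5 / 4 ^ i := by rw [pow_succ]; field_simp
  have hz0 : 0 ≤ z / 4 ^ i := by linarith
  have hz1 : z / 4 ^ i ≤ 1 / 5 / 4 ^ i := by linarith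
  rw [div_le_div_iff_of_pos_right h4] at hz1
  have hz0' : 0 ≤ z := by
    by_contra! h
    exact absurd hz0 (not_le.2 (div_neg_of_neg_of_pos h h4))
  have := quaternaryDigit_partial_add hmono n z 0 i hmin
  rw [add_zero] at this
  rw [hz, this, quaternaryDigit_zero (c := 0) (by push_cast; linarith) (by push_cast; linarith)]
  rfl

theorem cantorLabel_cantorPoint_eq_zero {k : ℕ → ℕ} (hk : ∀ n, k n + 2 ≤ k (n + 1))
    (he : ∀ n, Even (k n)) : cantorLabel (cantorPoint k) = 0 := by
  refine if_neg fun ⟨_, _, _, _, ho⟩ => ?_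
  obtain ⟨i, -, hodd, hi⟩ := ho 0
  rw [quaternaryDigit_cantorPoint_of_ne hk (fun n hn =>
    Nat.not_odd_iff_even.2 (he n) (hn ▸ hodd))] at hi
  norm_num at hi

theorem cantorLabel_cantorPoint_eq_one {k : ℕ → ℕ} (hk : ∀ n, k n + 2 ≤ k (n + 1))
    (hpar : ∀ n, Even (k n) ↔ Even n) : cantorLabel (cantorPoint k) = 1 := by
  have hmono := strictMono_of_add_two_le hk
  refine if_pos ⟨?_, ?_, fun i => ?_, fun K => ?_, fun K => ?_⟩
  · simpa [cantorPartial] using cantorPartial_le_cantorPoint hk 0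
  · have h1 := cantorPoint_le hk 0
    have h2 : (4 / 5 : ℝ) / 4 ^ k 0 ≤ 4 / 5 :=
      div_le_self (by norm_num) (one_le_pow₀ (by norm_num))
    simp only [cantorPartial, Finset.range_zero, Finset.sum_empty] at h1
    linarith
  · by_cases h : ∃ n, k n = i
    · obtain ⟨n, rfl⟩ := h
      exact Or.inr (quaternaryDigit_cantorPoint_self hk n)
    · push Not at h
      exact Or.inl (quaternaryDigit_cantorPoint_of_ne hk h)
  · exact ⟨k (2 * K), le_trans (by simp only [id]; omega) (hmono.id_le (2 * K)),
      (hpar _).2 (even_two_mul K), quaternaryDigit_cantorPoint_self hk _⟩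
  · refine ⟨k (2 * K + 1), le_trans (by simp only [id]; omega) (hmono.id_le (2 * K + 1)), ?_,
      quaternaryDigit_cantorPoint_self hk _⟩
    rw [← Nat.not_even_iff_odd, hpar, Nat.not_even_iff_odd]
    exact odd_two_mul_add_one K

theorem cantorLabel_block {k : ℕ → ℕ} (hk : StrictMono k) (n : ℕ) {y : ℝ} (h0 : 0 ≤ y)
    (h1 : y < 1) : cantorLabel (cantorPartial k n + y / 4 ^ (k n + 1)) = cantorLabel y :=
  cantorLabel_partial_add hk n y _ h0 h1 fun _ hi => (hk hi).trans (Nat.lt_succ_self _)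

/-- These points have digit 1 or 2 at position `k n`. -/
theorem cantorLabel_gap {k : ℕ → ℕ} (hk : StrictMono k) (n : ℕ) {x : ℝ}
    (h0 : cantorPartial k n + 1 / 4 ^ (k n + 1) ≤ x) (h1 : x < cantorPartial k (n + 1)) :
    cantorLabel x = 0 := by
  have h4 : (0 : ℝ) < 4 ^ k n := by positivity
  obtain ⟨z, rfl⟩ : ∃ z, x = cantorPartial k n + z / 4 ^ k n :=
    ⟨(x - cantorPartial k n) * 4 ^ k n, by field_simp; ring⟩
  rw [cantorPartial_succ, add_lt_add_iff_left, pow_succ,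
    div_mul_eq_div_div_swap, div_lt_div_iff_of_pos_right h4] at h1
  rw [add_le_add_iff_left, pow_succ, div_mul_eq_div_div_swap,
    div_le_div_iff_of_pos_right h4] at h0
  rw [cantorLabel_partial_add hk n z _ (by linarith) (by linarith) fun _ hi => hk hi,
    cantorLabel_of_middle h0 h1]

/-! ### Blowing up the past of a point of the Cantor set -/

theorem summable_mul_of_mul_two_pow_le {c A : ℕ → ℝ} (hc : ∀ n, 0 ≤ c n) (hA : ∀ n, 0 ≤ A n)
    (h : ∀ n, c n * A n * 2 ^ n ≤ 2) : Summable fun n => c n * A n := by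
  refine Summable.of_nonneg_of_le (fun n => mul_nonneg (hc n) (hA n)) (fun n => ?_)
    (summable_geometric_two.mul_left 2)
  rw [one_div, inv_pow, ← div_eq_mul_inv, le_div_iff₀ (by positivity)]
  exact h n

theorem DerivBounded.exists_nonneg {m : ℕ → ℝ} (hm : ∀ k, 0 < m k) {f : ℝ → ℝ}
    (hf : DerivBounded m f) : ∃ A, 0 ≤ A ∧ ∀ k x, |iteratedDeriv k f x| ≤ A * m k := by
  obtain ⟨-, A, hA⟩ := hf
  exact ⟨A, nonneg_of_mul_nonneg_left ((abs_nonneg _).trans (hA 0 0)) (hm 0), hA⟩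

/-- One sixteenth of the width of the `n`-th block of `accumulatingLabel`. -/
noncomputable def blockScale (n : ℕ) : ℝ := (1 / 4) ^ n / 64

theorem blockScale_pos (n : ℕ) : 0 < blockScale n := by
  unfold blockScale; positivity

theorem blockScale_zero : blockScale 0 = 1 / 64 := by simp [blockScale]

theorem blockScale_succ (n : ℕ) : blockScale (n + 1) = blockScale n / 4 := by
  simp only [blockScale, pow_succ]; ring

theorem four_pow_mul_blockScale (n : ℕ) : 4 ^ n * blockScale n = 1 / 64 := by
  rw [blockScale, mul_div_assoc', ← mul_pow]; norm_num

theorem tendsto_blockScale : Filter.Tendsto blockScale Filter.atTop (nhds 0) := by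
  have h := (tendsto_pow_atTop_nhds_zero_of_lt_one (by norm_num)
    (by norm_num : (1 / 4 : ℝ) < 1)).div_const 64
  rw [zero_div] at h
  exact h

theorem exists_mul_blockScale_near {x C : ℝ} (hC : 0 < C) (hx : x < 0)
    (hx' : -C * blockScale 0 ≤ x) :
    ∃ n, -C * blockScale n ≤ x ∧ x < -C * blockScale (n + 1) := by
  rw [blockScale_zero] at hx'
  obtain ⟨n, hn1, hn2⟩ := exists_nat_pow_near_of_lt_one (x := -x * (64 / C)) (y := 1 / 4)
    (by have := neg_pos.2 hx; positivity)
    (by rw [← mul_div_assoc, div_le_one hC]; linarith) (by norm_num) (by norm_num)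
  rw [← mul_div_assoc] at hn1 hn2
  rw [lt_div_iff₀ hC] at hn1
  rw [div_le_iff₀ hC] at hn2
  exact ⟨n, by rw [blockScale]; linarith, by rw [blockScale]; linarith⟩

open Classical in
/-- Copies of `cantorLabel` on the intervals `[-56 u, -40 u)` with `u = blockScale n`, extended
by zero. -/
noncomputable def accumulatingLabel (x : ℝ) : ℝ :=
  if h : ∃ n : ℕ, -56 * blockScale n ≤ x ∧ x < -40 * blockScale n then
    cantorLabel ((x + 56 * blockScale h.choose) / (16 * blockScale h.choose))
  else 0

/-- `ψ` maps `[-56 u, -40 u]`, `u = blockScale n`, affinely onto the `n`-th block to the left of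
`cantorPoint k`. The steps used do not depend on `k`, only their coefficients do, so the growth `D`
that ensures convergence can be fixed in advance. -/
theorem HasRamps.exists_blowUp {m : ℕ → ℝ} (hr : HasRamps m) (hm : ∀ k, 0 < m k) :
    ∃ D : ℕ → ℝ, ∀ k : ℕ → ℕ, (∀ n, k n + 2 ≤ k (n + 1)) → (∀ n, D n ≤ 4 ^ k n) →
      ∃ ψ : ℝ ≃o ℝ, LocDerivBounded m ψ ∧ ψ 0 = cantorPoint k ∧
        ∀ x < 0, cantorLabel (ψ x) = accumulatingLabel x := by
  set u : ℕ → ℝ := blockScale with hu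
  have hu0 : ∀ n, 0 < u n := blockScale_pos
  have hus : ∀ n, u (n + 1) = u n / 4 := blockScale_succ
  have huanti : Antitone u := antitone_nat_of_succ_le fun n => by rw [hus]; linarith [hu0 n]
  have hult : ∀ i n, i < n → 4 * u n ≤ u i := fun i n h => by
    have := huanti (show i + 1 ≤ n from h)
    rw [hus] at this
    linarith
  -- `V n` has slope 1 on `[-61 u, -39 u]`, around the block; `S n` lives on `[-40 u, -14 u]`, where
  -- `-14 * u n = -56 * u (n + 1)` is the start of the next block, and has slope 1 on `[-39 u, -15
  -- u]`.
  have hstepV := fun n : ℕ => hr.exists_step hm (p := -62 * u n) (q := -38 * u n) (w := u n)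
    (hu0 n) (by linarith [hu0 n])
  have hstepS := fun n : ℕ => hr.exists_step hm (p := -(79 / 2) * u n) (q := -(29 / 2) * u n)
    (w := u n / 2) (by linarith [hu0 n]) (by linarith [hu0 n])
  choose V hVb hVm hV0 hV1 hVa using hstepV
  choose S hSb hSm hS0 hS1 hSa using hstepS
  choose A hA0 hA using fun n => (hVb n).exists_nonneg hm
  choose B hB0 hB using fun n => (hSb n).exists_nonneg hm
  refine ⟨fun n => max (4 ^ n * A n * 2 ^ n) (3 * 4 ^ n * B n * 2 ^ n), fun k hk hD => ?_⟩
  have hkm := strictMono_of_add_two_le hk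
  set l : ℕ → ℝ := fun n => 1 / 4 ^ (k n + 1) with hl
  have hl0 : ∀ n, 0 < l n := fun n => by positivity
  have hl1 : ∀ n, l (n + 1) ≤ l n := fun n => by
    simp only [hl]
    have := hkm (Nat.lt_succ_self n)
    gcongr
    norm_num
  have hlk : ∀ n, l n * 4 ^ k n = 1 / 4 := fun n => by simp only [hl, pow_succ]; field_simp
  -- The slope `c n` stretches width `16 u` to `l n`. Consecutive blocks start `3 * l n` apart: `V
  -- n` supplies `l n` on the block and `l n / 8` after it, `V (n + 1)` supplies `3 / 8 * l (n + 1)`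
  -- before the next block, and `d n` makes `S n` supply the rest.
  set c : ℕ → ℝ := fun n => l n / (16 * u n) with hc
  set d : ℕ → ℝ := fun n => (15 / 8 * l n - 3 / 8 * l (n + 1)) / (25 * u n) with hd
  have hc0 : ∀ n, 0 < c n := fun n => div_pos (hl0 n) (by linarith [hu0 n])
  have hd0 : ∀ n, 0 < d n := fun n =>
    div_pos (by linarith [hl0 n, hl1 n]) (by linarith [hu0 n])
  have hu4 : ∀ n, 4 ^ n * u n = 1 / 64 := four_pow_mul_blockScale
  have hsV : Summable fun n => c n * A n := by
    refine summable_mul_of_mul_two_pow_le (fun n => (hc0 n).le) hA0 fun n => ?_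
    have h1 := (le_max_left _ _).trans (hD n)
    have h2 : c n = 4 * (4 ^ n * l n) := by
      have h3 := hu4 n
      have h4 := hu0 n
      simp only [hc]
      rw [div_eq_iff (by positivity)]
      linear_combination (-64 * l n) * h3
    calc c n * A n * 2 ^ n = 4 * (l n * (4 ^ n * A n * 2 ^ n)) := by rw [h2]; ring
      _ ≤ 4 * (l n * 4 ^ k n) := by have := hl0 n; gcongr
      _ ≤ 2 := by rw [hlk]; norm_num
  have hsS : Summable fun n => d n * B n := by
    refine summable_mul_of_mul_two_pow_le (fun n => (hd0 n).le) hB0 fun n => ?_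
    have h1 := (le_max_right _ _).trans (hD n)
    have h2 : d n ≤ 2 * (3 * (4 ^ n * l n)) := by
      have h3 := hu4 n
      have h4 := hu0 n
      have h5 := hl0 n
      have h6 := hl0 (n + 1)
      simp only [hd]
      rw [div_le_iff₀ (by positivity)]
      have : 2 * (3 * (4 ^ n * l n)) * (25 * u n) = 150 / 64 * l n := by
        linear_combination (150 * l n) * h3
      rw [this]
      linarith
    calc d n * B n * 2 ^ n ≤ 2 * (3 * (4 ^ n * l n)) * B n * 2 ^ n := by
          have := hB0 n; gcongr
      _ = 2 * (l n * (3 * 4 ^ n * B n * 2 ^ n)) := by ring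
      _ ≤ 2 * (l n * 4 ^ k n) := by have := hl0 n; gcongr
      _ ≤ 2 := by rw [hlk]; norm_num
  obtain ⟨hGV, hGVs⟩ := DerivBounded.tsum (fun n => (hVb n).1) hA (fun n => (hc0 n).le) hsV
  obtain ⟨hGS, hGSs⟩ := DerivBounded.tsum (fun n => (hSb n).1) hB (fun n => (hd0 n).le) hsS
  have hmV := monotone_tsum_mul hVm (fun n => (hc0 n).le) hGVs
  have hmS := monotone_tsum_mul hSm (fun n => (hd0 n).le) hGSs
  -- The constant cancels the rise of `V 0` before the first block, so that `g (-56 * u 0) = 0`.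
  set g : ℝ → ℝ := fun x => -(3 / 8) * l 0 + ((∑' n, c n * V n x) + ∑' n, d n * S n x) with hg
  have hgb : DerivBounded m g := (derivBounded_const hm _).add (hGV.add hGS)
  have hgm : Monotone g := fun x y hxy => add_le_add le_rfl (add_le_add (hmV hxy) (hmS hxy))
  have hgs : StrictMonoOn g (Set.Icc (-56 * u 0) 0) := by
    intro x hx y hy hxy
    obtain ⟨n, hn2, hn1⟩ := exists_mul_blockScale_near (x := x) (C := 60) (by norm_num)
      (hxy.trans_le hy.2) (by change -60 * u 0 ≤ x; linarith [hx.1, hu0 0])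
    have hn1' : x < -15 * u n := by
      have := hus n
      change x < -60 * u (n + 1) at hn1
      linarith
    have hn2' : -60 * u n ≤ x := hn2
    have hun := hu0 n
    refine add_lt_add_of_le_of_lt le_rfl ?_
    rcases lt_or_ge x (-39 * u n) with h | h
    · refine add_lt_add_of_lt_of_le ?_ (hmS hxy.le)
      refine tsum_mul_lt_tsum_mul hVm (fun n => (hc0 n).le) hGVs hxy.le (i := n) ?_ (hc0 n)
      refine lt_of_lt_of_le ?_ (hVm n (min_le_left y (-39 * u n)))
      have : x < min y (-39 * u n) := lt_min hxy h
      have h2 : min y (-39 * u n) ≤ -39 * u n := min_le_right _ _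
      rw [hVa n x (by linarith) (by linarith), hVa n _ (by linarith) (by linarith)]
      linarith
    · refine add_lt_add_of_le_of_lt (hmV hxy.le) ?_
      refine tsum_mul_lt_tsum_mul hSm (fun n => (hd0 n).le) hGSs hxy.le (i := n) ?_ (hd0 n)
      refine lt_of_lt_of_le ?_ (hSm n (min_le_left y (-15 * u n)))
      have : x < min y (-15 * u n) := lt_min hxy hn1'
      have h2 : min y (-15 * u n) ≤ -15 * u n := min_le_right _ _
      rw [hSa n x (by linarith) (by linarith), hSa n _ (by linarith) (by linarith)]
      linarith
  have hblock : ∀ n x, -56 * u n ≤ x → x ≤ -40 * u n →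
      g x = cantorPartial k n + (x + 56 * u n) / (16 * u n) / 4 ^ (k n + 1) := by
    intro n x h1 h2
    have hun := hu0 n
    have hV : ∑' i, c i * V i x = ∑ i ∈ Finset.range (n + 1), c i * V i x := by
      refine tsum_eq_sum fun i hi => ?_
      have : n < i := by simpa [Nat.lt_succ_iff] using hi
      have := hult n i this
      rw [hV0 i x (by linarith [hu0 i]), mul_zero]
    have hS : ∑' i, d i * S i x = ∑ i ∈ Finset.range n, d i * S i x := by
      refine tsum_eq_sum fun i hi => ?_
      have : n ≤ i := by simpa using hi
      have := huanti this
      rw [hS0 i x (by linarith [hu0 i]), mul_zero]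
    have hsum : ∀ n, -(3 / 8) * l 0 + (∑ i ∈ Finset.range n, c i * (24 * u i) +
        ∑ i ∈ Finset.range n, d i * (25 * u i)) + 3 / 8 * l n = cantorPartial k n := by
      intro n
      induction n with
      | zero => simp [cantorPartial]
      | succ n ih =>
        rw [cantorPartial_succ, ← ih, Finset.sum_range_succ, Finset.sum_range_succ]
        have h3 : c n * (24 * u n) = 3 / 2 * l n := by
          have := (hu0 n).ne'
          simp only [hc]; field_simp; ring
        have h4 : d n * (25 * u n) = 15 / 8 * l n - 3 / 8 * l (n + 1) := by
          have := (hu0 n).ne'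
          simp only [hd]; field_simp
        have h5 : (3 : ℝ) / 4 ^ (k n + 1) = 3 * l n := by simp only [hl]; ring
        rw [h3, h4, h5]
        ring
    have hVi : ∑ i ∈ Finset.range n, c i * V i x = ∑ i ∈ Finset.range n, c i * (24 * u i) := by
      refine Finset.sum_congr rfl fun i hi => ?_
      have := hult i n (Finset.mem_range.1 hi)
      rw [hV1 i x (by linarith [hu0 i])]
      ring
    have hSi : ∑ i ∈ Finset.range n, d i * S i x = ∑ i ∈ Finset.range n, d i * (25 * u i) := by
      refine Finset.sum_congr rfl fun i hi => ?_
      have := hult i n (Finset.mem_range.1 hi)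
      rw [hS1 i x (by linarith [hu0 i])]
      ring
    simp only [hg]
    have h6 : c n * (x - -62 * u n) = 3 / 8 * l n + (x + 56 * u n) / (16 * u n) * l n := by
      simp only [hc]; field_simp; ring
    have h7 : (x + 56 * u n) / (16 * u n) / 4 ^ (k n + 1) = (x + 56 * u n) / (16 * u n) * l n := by
      simp only [hl]; ring
    rw [hV, hS, Finset.sum_range_succ, hVi, hSi, hVa n x (by linarith) (by linarith), ← hsum n, h6,
      h7]
    ring
  obtain ⟨ψ, hψ, hψg⟩ := hr.exists_orderIso hm hgb hgm hgs
  have hψblock : ∀ n x, -56 * u n ≤ x → x ≤ -40 * u n →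
      ψ x = cantorPartial k n + (x + 56 * u n) / (16 * u n) / 4 ^ (k n + 1) := by
    intro n x h1 h2
    rw [hψg x ⟨?_, ?_⟩, hblock n x h1 h2]
    · have := huanti (Nat.zero_le n)
      linarith
    · linarith [hu0 n]
  have hψstart : ∀ n, ψ (-56 * u n) = cantorPartial k n := fun n => by
    rw [hψblock n _ le_rfl (by linarith [hu0 n])]
    simp
  have hψend : ∀ n, ψ (-40 * u n) = cantorPartial k n + 1 / 4 ^ (k n + 1) := fun n => by
    have := hu0 n
    rw [hψblock n _ (by linarith) le_rfl, show -40 * u n + 56 * u n = 16 * u n by ring,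
      div_self (by positivity)]
  refine ⟨ψ, hψ, ?_, fun x hx => ?_⟩
  · have hlim : Filter.Tendsto (fun n => -56 * u n) Filter.atTop (nhds 0) := by
      simpa using tendsto_blockScale.const_mul (-56)
    refine tendsto_nhds_unique ((hψ.1.continuous.tendsto 0).comp hlim) ?_
    simp only [Function.comp_def, hψstart]
    exact tendsto_cantorPartial hk
  · rw [accumulatingLabel]
    split_ifs with h
    · obtain ⟨h1, h2⟩ := h.choose_spec
      have hun := hu0 h.choose
      rw [hψblock h.choose x h1 h2.le]
      refine cantorLabel_block hkm _ (div_nonneg (by linarith) (by linarith)) ?_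
      rw [div_lt_one (by linarith)]
      linarith
    · by_cases hx' : x < -56 * u 0
      · refine cantorLabel_of_neg ?_
        have := ψ.strictMono hx'
        rw [hψstart] at this
        simpa [cantorPartial] using this
      · obtain ⟨n, hn2', hn1'⟩ := exists_mul_blockScale_near (x := x) (C := 56) (by norm_num) hx
          (not_lt.1 hx')
        have hn3 : -40 * u n ≤ x := by
          by_contra! hlt
          exact h ⟨n, hn2', hlt⟩
        refine cantorLabel_gap hkm n ?_ ?_
        · rw [← hψend]; exact ψ.monotone hn3
        · rw [← hψstart]; exact ψ.strictMono hn1'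

/-! ### Compressing a set of positive measure into the Cantor set -/

theorem two_mul_natFloor_le {a : ℝ} (ha : 0 ≤ a) :
    ⌊2 * a⌋₊ = 2 * ⌊a⌋₊ ∨ ⌊2 * a⌋₊ = 2 * ⌊a⌋₊ + 1 := by
  have h1 := Nat.floor_le ha
  have h2 := Nat.lt_floor_add_one a
  have h3 : 2 * ⌊a⌋₊ ≤ ⌊2 * a⌋₊ := Nat.le_floor (by push_cast; linarith)
  have h4 : ⌊2 * a⌋₊ < 2 * ⌊a⌋₊ + 2 :=
    (Nat.floor_lt (by linarith)).2 (by push_cast; linarith)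
  omega

/-- The positions of the digits `3` coding the binary digits of `x` in the windows given by `q`. -/
noncomputable def codingPositions (q : ℕ → ℕ) (x : ℝ) (n : ℕ) : ℕ :=
  if ⌊2 ^ (n + 1) * x⌋₊ = 2 * ⌊2 ^ n * x⌋₊ then q n + 2 else q n

/-- A binary digit 1 moves a 3 from position `q n + 2` to `q n`, adding `(48 - 3) / 4 ^ (q n + 3)`.
Binary digits are not monotone in `x`, but the floors are; summation by parts rewrites the sum over
digits as one over floors, whose coefficients are positive. -/
theorem cantorPoint_codingPositions {q : ℕ → ℕ} (hq : ∀ n, q n + 4 ≤ q (n + 1)) {x : ℝ}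
    (hx : x ∈ Set.Ico (0 : ℝ) 1)
    (hs : Summable fun n => ((45 : ℝ) / 4 ^ (q n + 3) - 2 * (45 / 4 ^ (q (n + 1) + 3))) *
      ⌊2 ^ (n + 1) * x⌋₊) :
    cantorPoint (codingPositions q x) = ∑' n, (3 : ℝ) / 4 ^ (q n + 3) +
      ∑' n, ((45 : ℝ) / 4 ^ (q n + 3) - 2 * (45 / 4 ^ (q (n + 1) + 3))) *
        ⌊2 ^ (n + 1) * x⌋₊ := by
  have hqm : StrictMono q := strictMono_nat_of_lt_succ fun n => by have := hq n; omega
  set F : ℕ → ℕ := fun n => ⌊2 ^ n * x⌋₊ with hF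
  have hF0 : F 0 = 0 := by simp [hF, Nat.floor_eq_zero, hx.2]
  have hFs : ∀ n, F (n + 1) = 2 * F n ∨ F (n + 1) = 2 * F n + 1 := fun n => by
    have := two_mul_natFloor_le (a := 2 ^ n * x) (mul_nonneg (by positivity) hx.1)
    rwa [← mul_assoc, ← pow_succ'] at this
  set k := codingPositions q x with hk
  have hkv : ∀ n, k n = if F (n + 1) = 2 * F n then q n + 2 else q n := fun n => rfl
  have hk2 : ∀ n, k n + 2 ≤ k (n + 1) := fun n => by
    have := hq n
    rw [hkv, hkv]
    split_ifs <;> omega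
  have hterm : ∀ n, (3 : ℝ) / 4 ^ (k n + 1) =
      3 / 4 ^ (q n + 3) + 45 / 4 ^ (q n + 3) * ((F (n + 1) : ℝ) - 2 * F n) := by
    intro n
    rw [hkv]
    rcases hFs n with h | h
    · rw [if_pos h, h]; push_cast; ring
    · rw [if_neg (by omega), h, pow_succ, pow_add]; push_cast; field_simp; ring
  have hpart : ∀ N, cantorPartial k N - 2 * (45 / 4 ^ (q N + 3) * (F N : ℝ)) =
      ∑ n ∈ Finset.range N, (3 : ℝ) / 4 ^ (q n + 3) +
      ∑ n ∈ Finset.range N, ((45 : ℝ) / 4 ^ (q n + 3) - 2 * (45 / 4 ^ (q (n + 1) + 3))) *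
        F (n + 1) := by
    intro N
    induction N with
    | zero => simp [cantorPartial, hF0]
    | succ N ih =>
      rw [cantorPartial_succ, Finset.sum_range_succ, Finset.sum_range_succ, hterm]
      linear_combination ih
  have hq4 : Summable fun n => (3 : ℝ) / 4 ^ (q n + 3) := by
    have h := summable_cantorPoint (k := fun n => q n + 2) fun n => by have := hq n; omega
    exact h
  have hrest : Filter.Tendsto (fun N => 2 * (45 / 4 ^ (q N + 3) * (F N : ℝ))) Filter.atTop
      (nhds 0) := by
    have h2 := (tendsto_pow_atTop_nhds_zero_of_lt_one (by norm_num)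
      (by norm_num : (1 / 2 : ℝ) < 1)).const_mul 2
    rw [mul_zero] at h2
    refine squeeze_zero (fun N => by positivity) (fun N => ?_) h2
    have h3 : (F N : ℝ) ≤ 2 ^ N :=
      (Nat.floor_le (mul_nonneg (by positivity) hx.1)).trans
        (mul_le_of_le_one_right (by positivity) hx.2.le)
    have h4 : (4 : ℝ) ^ N ≤ 4 ^ q N := pow_le_pow_right₀ (by norm_num) (hqm.id_le N)
    refine mul_le_mul_of_nonneg_left ?_ (by norm_num)
    calc 45 / 4 ^ (q N + 3) * (F N : ℝ) ≤ 45 / (4 ^ N * 4 ^ 3) * 2 ^ N := by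
          rw [pow_add]; gcongr
      _ = 45 / 64 * (1 / 2) ^ N := by
          rw [show (4 : ℝ) = 2 * 2 by norm_num, mul_pow, one_div, inv_pow]; field_simp; norm_num
      _ ≤ (1 / 2) ^ N := mul_le_of_le_one_left (by positivity) (by norm_num)
  have h1 := (tendsto_cantorPartial hk2).sub hrest
  rw [sub_zero] at h1
  refine tendsto_nhds_unique h1 ?_
  simp only [hpart]
  exact hq4.hasSum.tendsto_sum_nat.add hs.hasSum.tendsto_sum_nat

/-- The points of `[0, 1)` staying away from the dyadic rationals. -/
def awayFromDyadics : Set ℝ :=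
  {x | x ∈ Set.Ico (0 : ℝ) 1 ∧ ∀ n : ℕ, ∀ j ∈ Finset.Ico (1 : ℕ) (2 ^ (n + 1)),
    3 * ((1 / 4) ^ n / 96) ≤ |x - (j : ℝ) / 2 ^ (n + 1)|}

/-- The removed balls at level `n` have total length at most `(1 / 8) * (1 / 2) ^ n`, hence at most
`1 / 4` altogether. -/
theorem volume_awayFromDyadics_ne_zero : MeasureTheory.volume awayFromDyadics ≠ 0 := by
  intro h0
  set w : ℕ → ℝ := fun n => 3 * ((1 / 4) ^ n / 96) with hw
  have hsub : Set.Ico (0 : ℝ) 1 ⊆ awayFromDyadics ∪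
      ⋃ n : ℕ, ⋃ j ∈ Finset.Ico (1 : ℕ) (2 ^ (n + 1)), Metric.ball ((j : ℝ) / 2 ^ (n + 1)) (w n) := by
    intro x hx
    by_cases h : x ∈ awayFromDyadics
    · exact Or.inl h
    · refine Or.inr ?_
      have : ∃ n : ℕ, ∃ j ∈ Finset.Ico (1 : ℕ) (2 ^ (n + 1)), |x - (j : ℝ) / 2 ^ (n + 1)| < w n := by
        by_contra! hcon
        exact h ⟨hx, hcon⟩
      obtain ⟨n, j, hj, hlt⟩ := this
      simp only [Set.mem_iUnion]
      exact ⟨n, j, hj, by rwa [Metric.mem_ball, Real.dist_eq]⟩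
  have hle : MeasureTheory.volume (⋃ n : ℕ, ⋃ j ∈ Finset.Ico (1 : ℕ) (2 ^ (n + 1)),
      Metric.ball ((j : ℝ) / 2 ^ (n + 1)) (w n)) ≤ ENNReal.ofReal (1 / 4) := by
    calc _ ≤ ∑' n : ℕ, ENNReal.ofReal (1 / 8 * (1 / 2) ^ n) := by
          refine (MeasureTheory.measure_iUnion_le _).trans (ENNReal.tsum_le_tsum fun n => ?_)
          refine (MeasureTheory.measure_biUnion_finset_le _ _).trans ?_
          simp only [Real.volume_ball, Finset.sum_const, Nat.card_Ico, nsmul_eq_mul]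
          rw [← ENNReal.ofReal_natCast, ← ENNReal.ofReal_mul (by positivity)]
          refine ENNReal.ofReal_le_ofReal ?_
          have h1 : ((2 ^ (n + 1) - 1 : ℕ) : ℝ) ≤ 2 ^ (n + 1) := by
            exact_mod_cast Nat.sub_le _ _
          calc _ ≤ 2 ^ (n + 1) * (2 * w n) := by
                refine mul_le_mul_of_nonneg_right h1 ?_
                simp only [hw]; positivity
            _ = 1 / 8 * (1 / 2) ^ n := by
                simp only [hw]
                rw [show (1 / 4 : ℝ) = 1 / 2 * (1 / 2) by norm_num, mul_pow, pow_succ, one_div,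
                  inv_pow]
                field_simp
                norm_num
      _ = ENNReal.ofReal (1 / 4) := by
          rw [← ENNReal.ofReal_tsum_of_nonneg (fun n => by positivity)
            (summable_geometric_two.mul_left _), tsum_mul_left, tsum_geometric_two]
          norm_num
  have h1 := (MeasureTheory.measure_mono (μ := MeasureTheory.volume) hsub).trans (MeasureTheory.measure_union_le _ _)
  rw [h0, zero_add, Real.volume_Ico] at h1
  have := h1.trans hle
  rw [ENNReal.ofReal_le_ofReal_iff (by norm_num)] at this
  norm_num at this

/-- A smooth stand-in for the floor of `2 ^ (n + 1) * x`: normalized steps at the dyadic points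
change only within `3 * w` of them, hence off `awayFromDyadics`. An interval longer than the mesh
contains such a point in its interior, which gives strict increase. -/
theorem HasRamps.exists_staircase {m : ℕ → ℝ} (hr : HasRamps m) (hm : ∀ k, 0 < m k) (n : ℕ) :
    ∃ Z : ℝ → ℝ, DerivBounded m Z ∧ Monotone Z ∧
      (∀ x ∈ awayFromDyadics, Z x = ⌊2 ^ (n + 1) * x⌋₊) ∧
      ∀ x y, 0 ≤ x → y ≤ 1 → 1 / 2 ^ (n + 1) < y - x → Z x < Z y := by
  set w : ℝ := (1 / 4) ^ n / 96 with hw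
  have hw0 : 0 < w := by positivity
  obtain ⟨T, hTb, hTm, hT0, hT1, hTa⟩ := hr.exists_step hm (p := -2 * w) (q := 2 * w) hw0
    (by linarith)
  have hN : (0 : ℝ) < 2 ^ (n + 1) := by positivity
  refine ⟨fun x => ∑ j ∈ Finset.Ico (1 : ℕ) (2 ^ (n + 1)), (4 * w)⁻¹ * T (x - (j : ℝ) / 2 ^ (n + 1)),
    ?_, ?_, ?_, ?_⟩
  · exact DerivBounded.sum hm _ fun j => (hTb.comp_sub_const _).const_mul _
  · intro x y hxy
    refine Finset.sum_le_sum fun j _ => mul_le_mul_of_nonneg_left (hTm (by linarith)) (by positivity)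
  · rintro x ⟨hx, hxd⟩
    have hx0 : 0 ≤ 2 ^ (n + 1) * x := mul_nonneg hN.le hx.1
    have hlt : ⌊2 ^ (n + 1) * x⌋₊ < 2 ^ (n + 1) := by
      rw [Nat.floor_lt hx0]
      push_cast
      nlinarith [hx.2]
    have hval : ∀ j ∈ Finset.Ico (1 : ℕ) (2 ^ (n + 1)), (4 * w)⁻¹ * T (x - (j : ℝ) / 2 ^ (n + 1)) =
        if j ≤ ⌊2 ^ (n + 1) * x⌋₊ then 1 else 0 := by
      intro j hj
      have hd := hxd n j hj
      rw [← hw] at hd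
      split_ifs with h
      · rw [Nat.le_floor_iff hx0, mul_comm, ← div_le_iff₀ hN] at h
        rw [abs_of_nonneg (by linarith)] at hd
        rw [hT1 _ (by linarith)]
        field_simp
        ring
      · rw [Nat.le_floor_iff hx0, mul_comm, ← div_le_iff₀ hN, not_le] at h
        rw [abs_of_neg (by linarith)] at hd
        rw [hT0 _ (by linarith), mul_zero]
    refine (Finset.sum_congr rfl hval).trans ?_
    rw [Finset.sum_boole]
    congr 1
    have : (Finset.Ico (1 : ℕ) (2 ^ (n + 1))).filter (fun j => j ≤ ⌊2 ^ (n + 1) * x⌋₊) =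
        Finset.Icc 1 ⌊2 ^ (n + 1) * x⌋₊ := by
      ext j
      simp only [Finset.mem_filter, Finset.mem_Ico, Finset.mem_Icc]
      omega
    rw [this, Nat.card_Icc, Nat.add_sub_cancel]
  · intro x y hx hy hxy
    have hx0 : 0 ≤ 2 ^ (n + 1) * x := mul_nonneg hN.le hx
    set j : ℕ := ⌊2 ^ (n + 1) * x⌋₊ + 1 with hj
    have h1 : 2 ^ (n + 1) * x < j := by push_cast [hj]; exact Nat.lt_floor_add_one _
    have h2 : (j : ℝ) ≤ 2 ^ (n + 1) * x + 1 := by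
      push_cast [hj]; linarith [Nat.floor_le hx0]
    have h3 : x < (j : ℝ) / 2 ^ (n + 1) := by rw [lt_div_iff₀ hN]; linarith
    have h4 : (j : ℝ) / 2 ^ (n + 1) < y := by
      have : (j : ℝ) / 2 ^ (n + 1) ≤ x + 1 / 2 ^ (n + 1) := by
        rw [div_le_iff₀ hN, add_mul, one_div, inv_mul_cancel₀ hN.ne']
        linarith
      linarith
    have h5 : j < 2 ^ (n + 1) := by
      have := h4.trans_le hy
      rw [div_lt_one hN] at this
      exact_mod_cast this
    refine Finset.sum_lt_sum (fun i _ => mul_le_mul_of_nonneg_left (hTm (by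
      have : 0 < 1 / (2 : ℝ) ^ (n + 1) := by positivity
      linarith)) (by positivity)) ⟨j, by rw [Finset.mem_Ico]; omega, ?_⟩
    refine mul_lt_mul_of_pos_left ?_ (by positivity)
    set a := x - (j : ℝ) / 2 ^ (n + 1)
    set b := y - (j : ℝ) / 2 ^ (n + 1)
    have ha : a < 0 := by simp only [a]; linarith
    have hb : 0 < b := by simp only [b]; linarith
    refine (hTm (le_max_left a (-w))).trans_lt (lt_of_lt_of_le ?_ (hTm (min_le_left b w)))
    have e1 : max a (-w) < 0 := max_lt ha (by linarith)
    have e2 : 0 < min b w := lt_min hb hw0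
    have e3 : -w ≤ max a (-w) := le_max_right _ _
    have e4 : min b w ≤ w := min_le_right _ _
    rw [hTa _ (by linarith) (by linarith), hTa _ (by linarith) (by linarith)]
    linarith

/-- Replacing the floors in `cantorPoint_codingPositions` by smooth staircases changes nothing on
`awayFromDyadics`, and fast growth of `q` makes the series converge in the weighted class. -/
theorem HasRamps.exists_compression {m : ℕ → ℝ} (hr : HasRamps m) (hm : ∀ k, 0 < m k) :
    ∃ D : ℕ → ℝ, ∀ q : ℕ → ℕ, (∀ n, q n + 4 ≤ q (n + 1)) → (∀ n, D n ≤ 4 ^ q n) →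
      ∃ φ : ℝ ≃o ℝ, LocDerivBounded m φ ∧
        ∀ x ∈ awayFromDyadics, φ x = cantorPoint (codingPositions q x) := by
  choose Z hZb hZm hZf hZs using hr.exists_staircase hm
  choose A hA0 hA using fun n => (hZb n).exists_nonneg hm
  refine ⟨fun n => A n * 2 ^ n, fun q hq hD => ?_⟩
  set c : ℕ → ℝ := fun n => (45 : ℝ) / 4 ^ (q n + 3) - 2 * (45 / 4 ^ (q (n + 1) + 3)) with hc
  have hc0 : ∀ n, 0 < c n := by
    intro n
    have h1 : (45 : ℝ) / 4 ^ (q (n + 1) + 3) ≤ 45 / 4 ^ (q n + 3 + 1) := by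
      have h : q n + 3 + 1 ≤ q (n + 1) + 3 := by have := hq n; omega
      exact div_le_div_of_nonneg_left (by norm_num) (by positivity)
        (pow_le_pow_right₀ (by norm_num) h)
    have h2 : (45 : ℝ) / 4 ^ (q n + 3 + 1) = 45 / 4 ^ (q n + 3) / 4 := by
      rw [pow_succ, div_div]
    have h3 : (0 : ℝ) < 45 / 4 ^ (q n + 3) := by positivity
    simp only [hc]
    linarith
  have hc1 : ∀ n, c n * 4 ^ q n ≤ 2 := by
    intro n
    calc c n * 4 ^ q n ≤ 45 / 4 ^ (q n + 3) * 4 ^ q n := by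
          refine mul_le_mul_of_nonneg_right (sub_le_self _ (by positivity)) (by positivity)
      _ = 45 / 64 := by rw [pow_add]; field_simp; norm_num
      _ ≤ 2 := by norm_num
  have hs : Summable fun n => c n * A n := by
    refine summable_mul_of_mul_two_pow_le (fun n => (hc0 n).le) hA0 fun n => ?_
    rw [mul_assoc]
    exact (mul_le_mul_of_nonneg_left (hD n) (hc0 n).le).trans (hc1 n)
  obtain ⟨hG, hGs⟩ := DerivBounded.tsum (fun n => (hZb n).1) hA (fun n => (hc0 n).le) hs
  have hGm := monotone_tsum_mul hZm (fun n => (hc0 n).le) hGs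
  obtain ⟨φ, hφ, hφg⟩ := hr.exists_orderIso hm (a := 0) (b := 1)
    (g := fun x => ∑' n, (3 : ℝ) / 4 ^ (q n + 3) + ∑' n, c n * Z n x)
    ((derivBounded_const hm _).add hG) (fun x y hxy => add_le_add le_rfl (hGm hxy))
    (fun x hx y hy hxy => by
      obtain ⟨n, hn⟩ := exists_pow_lt_of_lt_one (sub_pos.2 hxy) (by norm_num : (1 / 2 : ℝ) < 1)
      refine add_lt_add_of_le_of_lt le_rfl (tsum_mul_lt_tsum_mul hZm (fun n => (hc0 n).le) hGs
        hxy.le (i := n) (hZs n x y hx.1 hy.2 (lt_of_le_of_lt ?_ hn)) (hc0 n))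
      rw [one_div, ← inv_pow, ← one_div]
      exact pow_le_pow_of_le_one (by norm_num) (by norm_num) (Nat.le_succ n))
  refine ⟨φ, hφ, fun x hx => ?_⟩
  have hZx : ∀ n, c n * Z n x = c n * ⌊2 ^ (n + 1) * x⌋₊ := fun n => by rw [hZf n x hx]
  have hsx := hGs x
  simp only [hZx] at hsx
  rw [hφg x ⟨hx.1.1, hx.1.2.le⟩, cantorPoint_codingPositions hq hx.1 hsx]
  simp only [hZx]
  rfl

/-! ### There is no good anonymous predictor -/

theorem exists_rapidly_growing (D : ℕ → ℝ) {ε : ℕ → ℕ} (hε : ∀ n, ε n ≤ 1) :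
    ∃ q : ℕ → ℕ, (∀ n, q n + 4 ≤ q (n + 1)) ∧ (∀ n, D n ≤ 4 ^ q n) ∧
      ∀ n, Even (q n) ↔ Even (ε n) := by
  choose e he using fun n => pow_unbounded_of_one_lt (D n) (by norm_num : (1 : ℝ) < 4)
  refine ⟨fun n => 2 * ∑ i ∈ Finset.range (n + 1), (e i + 3) + ε n, fun n => ?_, fun n => ?_,
    fun n => ?_⟩
  -- Each summand `e i + 3` adds at least 6, so `q` still grows by at least 4 after the parity
  -- correction `ε`.
  · have := hε n
    simp only
    rw [Finset.sum_range_succ _ (n + 1)]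
    omega
  · refine (he n).le.trans (pow_le_pow_right₀ (by norm_num) ?_)
    simp only [Finset.sum_range_succ]
    omega
  · simp [Nat.even_add]

theorem codingPositions_eq_or (q : ℕ → ℕ) (x : ℝ) (n : ℕ) :
    codingPositions q x n = q n + 2 ∨ codingPositions q x n = q n := by
  unfold codingPositions
  split_ifs <;> simp

theorem even_codingPositions (q : ℕ → ℕ) (x : ℝ) (n : ℕ) :
    Even (codingPositions q x n) ↔ Even (q n) := by
  rcases codingPositions_eq_or q x n with h | h <;> simp [h, Nat.even_add]

theorem codingPositions_add_two_le {q : ℕ → ℕ} (hq : ∀ n, q n + 4 ≤ q (n + 1)) (x : ℝ) (n : ℕ) :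
    codingPositions q x n + 2 ≤ codingPositions q x (n + 1) := by
  have := hq n
  rcases codingPositions_eq_or q x n with h | h <;>
    rcases codingPositions_eq_or q x (n + 1) with h' | h' <;> omega

theorem Predictor.IsGood.exists_mem_eq {P : Predictor ℝ} (hP : P.IsGood) (F : ℝ → ℝ) {C : Set ℝ}
    (hC : MeasureTheory.volume C ≠ 0) : ∃ x ∈ C, P x (history F x) = F x := by
  by_contra! h
  exact hC (MeasureTheory.measure_mono_null (fun x hx => h x hx) (hP F))

theorem Predictor.IsAnonymous.apply_history_comp {Γ : Set (ℝ → ℝ)} {P : Predictor ℝ}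
    (hP : P.IsAnonymous Γ) (F : ℝ → ℝ) {φ : ℝ ≃o ℝ} (hφ : (φ : ℝ → ℝ) ∈ Γ) (s : ℝ) :
    P s (history (F ∘ φ) s) = P (φ s) (history F (φ s)) :=
  hP φ hφ s (history F (φ s))

theorem mainTheorem5 (Γ : Set (ℝ → ℝ)) (hΓ : IsLocallyDenjoyCarlemanClass Γ)
    (hqa : ¬ IsQuasiAnalyticClass Γ) :
    ¬ ∃ P : Predictor ℝ, P.IsGood ∧ P.IsAnonymous Γ := by
  rintro ⟨P, hgood, hanon⟩
  obtain ⟨m, hm, hr, hmem⟩ := exists_hasRamps hΓ hqa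
  obtain ⟨D₁, hD₁⟩ := hr.exists_blowUp hm
  obtain ⟨D₂, hD₂⟩ := hr.exists_compression hm
  have key : ∀ ε : ℕ → ℕ, (∀ n, ε n ≤ 1) → ∃ k : ℕ → ℕ, (∀ n, k n + 2 ≤ k (n + 1)) ∧
      (∀ n, Even (k n) ↔ Even (ε n)) ∧
      P 0 (history accumulatingLabel 0) = cantorLabel (cantorPoint k) := by
    intro ε hε
    obtain ⟨q, hq, hqD, hqε⟩ := exists_rapidly_growing (fun n => max (D₁ n) (D₂ n)) hε
    obtain ⟨φ, hφ, hφC⟩ := hD₂ q hq fun n => (le_max_right _ _).trans (hqD n)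
    obtain ⟨x, hx, hPx⟩ := hgood.exists_mem_eq (cantorLabel ∘ φ) volume_awayFromDyadics_ne_zero
    have hk := codingPositions_add_two_le hq x
    -- The two candidate positions `q n` and `q n + 2` have equal parity, so the parity pattern is
    -- known although `x` is not.
    refine ⟨codingPositions q x, hk, fun n => (even_codingPositions q x n).trans (hqε n), ?_⟩
    obtain ⟨ψ, hψ, hψ0, hψH⟩ := hD₁ (codingPositions q x) hk fun n =>
      ((le_max_left _ _).trans (hqD n)).trans (pow_le_pow_right₀ (by norm_num) (by
        rcases codingPositions_eq_or q x n with h | h <;> omega))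
    have hhist : history (cantorLabel ∘ ψ) 0 = history accumulatingLabel 0 :=
      funext fun y => hψH y y.2
    rw [← hhist, hanon.apply_history_comp _ (hmem _ hψ), hψ0, ← hφC x hx,
      ← hanon.apply_history_comp _ (hmem _ hφ), hPx, Function.comp_apply]
  obtain ⟨k, hk, hpar, hv⟩ := key (fun _ => 0) fun _ => Nat.zero_le _
  obtain ⟨k', hk', hpar', hv'⟩ := key (fun n => n % 2) fun n => by omega
  rw [cantorLabel_cantorPoint_eq_zero hk fun n => (hpar n).2 Even.zero] at hv
  rw [cantorLabel_cantorPoint_eq_one hk' fun n => (hpar' n).trans (by simp [Nat.even_iff])] at hv'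
  exact zero_ne_one (hv.symm.trans hv')
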